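/- Throughout, $\ell^2=\ell^2(\{0,1,2,\dots\})$ over $\mathbb{C}$ with standard basis $e_0,e_1,\dots$; a (bounded) Jacobi operator is a bounded operator $J$ on $\ell^2$ with real symmetric tridiagonal matrix: diagonal entries $\alpha_k\in\mathbb{R}$ and off-diagonal entries $\beta_k>0$ in positions $(k,k+1)$ and $(k+1,k)$, $k\ge 0$. The free Jacobi operator $\Delta$ is the one with $\alpha_k=0$ and $\beta_k=\tfrac12$. The Hausdorff metric on nonempty compact subsets of $\mathbb{C}$ is $d_H(A,B)=\max\{\sup_{a\in A}\operatorname{dist}(a,B),\ \sup_{b\in B}\operatorname{dist}(b,A)\}$. An *algorithm* is a program in exact real arithmetic: it handles natural numbers, real numbers, pairs and finite lists, has only the constants $0$ and $1$ built in, uses the operations $+,-,\times,/$, the comparison $<$, branching, recursion and unbounded search, and may query its input. A function $\Gamma$ from a class of inputs to a metric space $(\mathcal{M},d_{\mathcal{M}})$ is *computable with error control* if there is one algorithm which, for every input $A$ and every $n\in\mathbb{N}$, halts and outputs (a finite description of) an element $\Gamma_n(A)\in\mathcal{M}$ with $\Gamma_n(A)\to\Gamma(A)$ as $n\to\infty$,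 and one algorithm which, for every input $A$ and every real $\epsilon>0$, halts and outputs an $n$ with $d_{\mathcal{M}}(\Gamma_n(A),\Gamma(A))<\epsilon$. **Theorem.** Let $J=\Delta+K$ be a Toeplitz-plus-compact Jacobi operator, that is, a Jacobi operator such that $K=J-\Delta$ is compact. Suppose that for every $\epsilon>0$ a natural number $m$ can be computed such that $$\sup_{k\ge m}|\alpha_k|+\sup_{k\ge m}\left|\beta_k-\tfrac12\right|<\epsilon .$$ Then the spectrum $\sigma(J)$ can be computed with error control in the Hausdorff metric. Precisely: let an input be such an operator $J$ together with a function $M$ which assigns to each $\epsilon>0$ an $m=M(\epsilon)\in\mathbb{N}$ with the above property, where the input can be queried for $\alpha_k$ and $\beta_k$ (given $k$) and for $M(\epsilon)$ (given $\epsilon$), and let outputs be finite unions $[a_1,b_1]\cup\dots\cup[a_r,b_r]$ of closed bounded real intervals (possibly single points), given by the list of their end points. Then the function $(J,M)\mapsto\sigma(J)$ is computable with error control. -/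

import Mathlib

/-! ## Exact real arithmetic: data types, oracle programs, and their partial semantics -/

namespace RealRAM

/-- Data types handled by the programs: natural numbers, exact real numbers, pairs and finite
lists. -/
inductive Ty : Type
  | unit : Ty
  | nat : Ty
  | real : Ty
  | prod : Ty → Ty → Ty
  | list : Ty → Ty

/-- The set of values of a data type. -/
abbrev Ty.Val : Ty → Type
  | .unit => Unit
  | .nat => ℕ
  | .real => ℝ
  | .prod a b => a.Val × b.Val
  | .list a => List a.Val

/-- The queries which a program may put to its input datum, with the types of their arguments
and answers. -/
structure Signature where
  Query : Type
  dom : Query → Ty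
  cod : Query → Ty

/-- An input datum as seen by a program: an answer to every possible query. -/
def Signature.Datum (S : Signature) : Type :=
  (q : S.Query) → (S.dom q).Val → (S.cod q).Val

/-- Programs over exact real arithmetic with queries to the input datum (the partial recursive
functions over the ordered field `ℝ`, in the sense of Blum, Shub and Smale, in the style of
Kleene's scheme).  Only the constants `0` and `1` are built in, so a program is a finite
object which contains no information about any other real number. -/
inductive Prog (S : Signature) : Ty → Ty → Type
  | query (q : S.Query) : Prog S (S.dom q) (S.cod q)
  | id {a : Ty} : Prog S a a
  | comp {a b c : Ty} (g : Prog S b c) (f : Prog S a b) : Prog S a c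
  | drop {a : Ty} : Prog S a .unit
  | pair {a b c : Ty} (f : Prog S a b) (g : Prog S a c) : Prog S a (.prod b c)
  | fst {a b : Ty} : Prog S (.prod a b) a
  | snd {a b : Ty} : Prog S (.prod a b) b
  | zero : Prog S .unit .nat
  | succ : Prog S .nat .nat
  | rzero : Prog S .unit .real
  | rone : Prog S .unit .real
  | add : Prog S (.prod .real .real) .real
  | neg : Prog S .real .real
  | mul : Prog S (.prod .real .real) .real
  | inv : Prog S .real .real
  | lt : Prog S (.prod .real .real) .nat
  | nil {a : Ty} : Prog S .unit (.list a)
  | cons {a : Ty} : Prog S (.prod a (.list a)) (.list a)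
  | ifZero {a b : Ty} (c : Prog S a .nat) (f g : Prog S a b) : Prog S a b
  | natRec {a b : Ty} (f : Prog S a b) (g : Prog S (.prod a (.prod .nat b)) b) :
      Prog S (.prod a .nat) b
  | listRec {a b c : Ty} (f : Prog S a b)
      (g : Prog S (.prod a (.prod c (.prod (.list c) b))) b) : Prog S (.prod a (.list c)) b
  | search {a : Ty} (f : Prog S (.prod a .nat) .nat) : Prog S a .nat

open Classical in
/-- The partial function computed by a program on the input datum `O`; `y ∈ p.eval O x` means that
`p` halts on `x` (after finitely many arithmetic operations, comparisons and queries) with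
output `y`.  Division by zero is undefined, `lt` returns `1` or `0`, only the selected branch of
`ifZero` is run, and `search f` on `x` looks for the least `n` with `f (x, n) = 0`. -/
noncomputable def Prog.eval {S : Signature} (O : S.Datum) :
    {a b : Ty} → Prog S a b → a.Val → Part b.Val
  | _, _, .query q => fun x => Part.some (O q x)
  | _, _, .id => fun x => Part.some x
  | _, _, .comp g f => fun x => (f.eval O x).bind fun y => g.eval O y
  | _, _, .drop => fun _ => Part.some ()
  | _, _, .pair f g => fun x =>
      (f.eval O x).bind fun y => (g.eval O x).bind fun z => Part.some (y, z)
  | _, _, .fst => fun x => Part.some x.1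
  | _, _, .snd => fun x => Part.some x.2
  | _, _, .zero => fun _ => Part.some (0 : ℕ)
  | _, _, .succ => fun (n : ℕ) => Part.some (n + 1 : ℕ)
  | _, _, .rzero => fun _ => Part.some (0 : ℝ)
  | _, _, .rone => fun _ => Part.some (1 : ℝ)
  | _, _, .add => fun (x : ℝ × ℝ) => Part.some (x.1 + x.2 : ℝ)
  | _, _, .neg => fun (x : ℝ) => Part.some (-x : ℝ)
  | _, _, .mul => fun (x : ℝ × ℝ) => Part.some (x.1 * x.2 : ℝ)
  | _, _, .inv => fun (x : ℝ) => if x = 0 then Part.none else Part.some (x⁻¹ : ℝ)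
  | _, _, .lt => fun (x : ℝ × ℝ) => Part.some (if x.1 < x.2 then (1 : ℕ) else (0 : ℕ))
  | _, _, .nil => fun _ => Part.some []
  | _, _, .cons => fun x => Part.some (List.cons x.1 x.2)
  | _, _, .ifZero c f g => fun x =>
      (c.eval O x).bind fun n => if @Eq ℕ n (0 : ℕ) then f.eval O x else g.eval O x
  | _, _, .natRec f g => fun x =>
      Nat.rec (f.eval O x.1) (fun n ih => ih.bind fun y => g.eval O (x.1, (n, y))) (x.2 : ℕ)
  | _, _, .listRec f g => fun x =>
      List.rec (f.eval O x.1)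
        (fun h t ih => ih.bind fun y => g.eval O (x.1, (h, (t, y)))) x.2
  | _, _, .search f => fun x =>
      Nat.rfind fun n => (f.eval O (x, n)).map fun (k : ℕ) => decide (k = 0)

/-- The function `Γ` from a class `Ω` of inputs to a metric space `𝓜` is computable with error
control.  The input `A` is accessible through the queries `datum A`, and the elements of `𝓜`
which can be output are those which have a finite description (`Describes d G`: `d` describes
`G`).
There is one program which, for every input `A` and every `n`, halts with a description of an
element `Γₙ(A)` such that `Γₙ(A) → Γ(A)`; and there is one program which, for every input `A`
and every real `ε > 0`, halts with an `n` such that `dist (Γₙ(A)) (Γ(A)) < ε`. -/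
def ComputableWithErrorControl {S : Signature} {Ω : Type} (datum : Ω → S.Datum)
    {𝓜 : Type} [MetricSpace 𝓜] {out : Ty} (Describes : out.Val → 𝓜 → Prop)
    (Γ : Ω → 𝓜) : Prop :=
  ∃ (approx : Prog S .nat out) (index : Prog S .real .nat),
    ∀ A : Ω, ∃ G : ℕ → 𝓜,
      (∀ n : ℕ, ∃ d ∈ approx.eval (datum A) n, Describes d (G n)) ∧
      Filter.Tendsto G Filter.atTop (nhds (Γ A)) ∧
      ∀ ε : ℝ, 0 < ε → ∃ n : ℕ, n ∈ index.eval (datum A) ε ∧ dist (G n) (Γ A) < ε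

end RealRAM

/-! ## Toeplitz-plus-compact Jacobi operators -/

namespace Jacobi

/-- The complex Hilbert space `ℓ²({0, 1, 2, …})`. -/
abbrev Ell2 : Type := lp (fun _ : ℕ => ℂ) 2

/-- The standard basis vector `e_j`. -/
noncomputable def e (j : ℕ) : Ell2 := lp.single 2 j (1 : ℂ)

/-- The bounded operator `T` has, with respect to `e_0, e_1, …`, the symmetric tridiagonal matrix
with diagonal `a_0, a_1, …` and off-diagonal `b_0, b_1, …`. -/
def HasTridiagonalMatrix (T : Ell2 →L[ℂ] Ell2) (a b : ℕ → ℝ) : Prop :=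
  ∀ i j : ℕ, (T (e j) : ℕ → ℂ) i =
    if i = j then (a i : ℂ) else if j = i + 1 then (b i : ℂ) else
      if i = j + 1 then (b j : ℂ) else 0

theorem orthonormal_e_succ : Orthonormal ℂ fun j : ℕ => e (j + 1) := by
  rw [orthonormal_iff_ite]
  intro i j
  rw [e, e, lp.inner_single_left]
  by_cases h : i = j
  · subst h
    simp
  · rw [lp.single_apply_ne _ _ _ (by omega : i + 1 ≠ j + 1)]
    simp [h]

/-- The unilateral shift, `e_j ↦ e_{j+1}`. -/
noncomputable def shift : Ell2 →L[ℂ] Ell2 :=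
  orthonormal_e_succ.orthogonalFamily.linearIsometry.toContinuousLinearMap

theorem shift_e (j : ℕ) : shift (e j) = e (j + 1) := by
  change orthonormal_e_succ.orthogonalFamily.linearIsometry (lp.single 2 j (1 : ℂ)) = _
  rw [OrthogonalFamily.linearIsometry_apply_single]
  simp

/-- The free Jacobi operator `Δ`, half the sum of the shift and its adjoint. -/
noncomputable def Δ : Ell2 →L[ℂ] Ell2 :=
  (1 / 2 : ℂ) • (shift + ContinuousLinearMap.adjoint shift)

theorem e_apply (i j : ℕ) : (e j : ℕ → ℂ) i = if i = j then 1 else 0 := by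
  rw [e]
  by_cases h : i = j
  · subst h
    simp
  · rw [lp.single_apply_ne _ _ _ h]
    simp [h]

/-- `Δ` has diagonal `0` and off-diagonal `1/2`. -/
theorem Δ_matrix : HasTridiagonalMatrix Δ (fun _ => 0) (fun _ => 1 / 2) := by
  intro i j
  have h1 : (ContinuousLinearMap.adjoint shift (e j) : ℕ → ℂ) i = if j = i + 1 then 1 else 0 := by
    have h2 : inner ℂ (e i) (ContinuousLinearMap.adjoint shift (e j)) =
        (ContinuousLinearMap.adjoint shift (e j) : ℕ → ℂ) i := by
      rw [e, lp.inner_single_left]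
      simp
    rw [← h2, ContinuousLinearMap.adjoint_inner_right, shift_e, e, lp.inner_single_left, e_apply]
    simp [eq_comm]
  have h3 : (Δ (e j) : ℕ → ℂ) i =
      1 / 2 * ((e (j + 1) : ℕ → ℂ) i + (ContinuousLinearMap.adjoint shift (e j) : ℕ → ℂ) i) := by
    rw [← shift_e]
    rfl
  rw [h3, h1, e_apply]
  by_cases ha : i = j
  · subst ha
    simp
  · by_cases hb : j = i + 1
    · subst hb
      simp
      intro h
      omega
    · simp [ha, hb]

/-- An input: a Toeplitz-plus-compact Jacobi operator `J`, together with a modulus `M` which gives,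
for every `ε > 0`, an integer `m = M ε` with
`sup_{k ≥ m} |α k| + sup_{k ≥ m} |β k - 1/2| < ε`. -/
structure Input where
  α : ℕ → ℝ
  β : ℕ → ℝ
  β_pos : ∀ k, 0 < β k
  J : Ell2 →L[ℂ] Ell2
  J_matrix : HasTridiagonalMatrix J α β
  compact : IsCompactOperator (J - Δ)
  M : ℝ → ℕ
  M_spec : ∀ ε : ℝ, 0 < ε →
    (⨆ k : Set.Ici (M ε), |α k|) + (⨆ k : Set.Ici (M ε), |β k - 1 / 2|) < ε

/-- What a program may ask about an input. -/
inductive Query : Type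
  | diagonal : Query
  | offDiagonal : Query
  | modulus : Query

/-- The coefficients are real numbers indexed by natural numbers; the modulus takes a real `ε` to
a natural number. -/
def signature : RealRAM.Signature where
  Query := Query
  dom
    | .diagonal => .nat
    | .offDiagonal => .nat
    | .modulus => .real
  cod
    | .diagonal => .real
    | .offDiagonal => .real
    | .modulus => .nat

/-- The answers given by an input. -/
def Input.datum (A : Input) : signature.Datum
  | .diagonal => A.α
  | .offDiagonal => A.β
  | .modulus => A.M

/-- The spectrum `σ(J)`, as a point of the space of nonempty compact subsets of the complex plane,
whose distance is the Hausdorff metric. -/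
noncomputable def Input.spectrum (A : Input) : TopologicalSpace.NonemptyCompacts ℂ :=
  haveI : Nontrivial Ell2 := ⟨e 0, 0, fun h => by
    have := congrArg (fun v : Ell2 => (v : ℕ → ℂ) 0) h
    simp [e_apply] at this⟩
  ⟨⟨_root_.spectrum ℂ A.J, spectrum.isCompact A.J⟩, spectrum.nonempty A.J⟩

/-- The type of finite lists of pairs of real numbers. -/
abbrev intervals : RealRAM.Ty := .list (.prod .real .real)

/-- A list `(a₁, b₁), …, (a_r, b_r)` of pairs of reals describes the subset
`[a₁, b₁] ∪ … ∪ [a_r, b_r]` of the real line in the complex plane. -/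
def DescribesUnion (d : List (ℝ × ℝ)) (G : TopologicalSpace.NonemptyCompacts ℂ) : Prop :=
  (G : Set ℂ) = {z : ℂ | ∃ p ∈ d, ∃ x : ℝ, p.1 ≤ x ∧ x ≤ p.2 ∧ z = (x : ℂ)}

end Jacobi

/-! Exact arithmetic allows a finite search for approximate eigenvectors whose residuals are
computed without truncation error. Put ε = 1/(n+1). The n-th output is [-1, 1] together with every
point y of a finite grid for which some nonzero vector v of length N with entries in the same grid
satisfies ‖(J - y)v‖ ≤ ε‖v‖. Since J is tridiagonal, (J - y)v has at most N + 1 nonzero entries, so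
the test is finite and exact.

Every output point is near the spectrum. Truncated plane waves show [-1, 1] ⊆ σ(J)
(`mem_spectrum_of_abs_le_one`), and for self-adjoint J a relative residual ε puts y within ε of σ(J)
(`exists_mem_spectrum_of_norm_sub_le`).

Conversely, every spectral point is near the output. If |x| < 1 + 4ε, then x is within 4ε of [-1,
1]. Otherwise the task is to bound the support of an approximate eigenvector in terms of M(ε) alone,
which is `exists_cutoff`. Among R consecutive sites beyond M(ε) there is one where the vector is
small, and cutting it there costs little residual. The outer piece lives where J is nearly free,
with quadratic form too small for the value x, so that piece has little mass; the inner piece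
carries at least half. After normalisation, `perturb_approx_eigenvector` allows x and the entries to
be rounded to the grid, and the search finds the result.

The Hausdorff error is therefore at most 4/(n+1), which also gives the index program. It remains to
see that the scheme is a program, by means of a small calculus of total computable functions
(`Computes`). -/

namespace RealRAM

/-! ### A calculus of total computable functions. -/

variable {S : Signature} {Ω : Type} {datum : Ω → S.Datum} {a b c : Ty}

/-- The total function `f` is computed by one program, uniformly in the input. -/
def Computes (datum : Ω → S.Datum) (a b : Ty) (f : Ω → a.Val → b.Val) : Prop :=
  ∃ p : Prog S a b, ∀ A x, p.eval (datum A) x = Part.some (f A x)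

namespace Computes

theorem comp {g : Ω → b.Val → c.Val} {f : Ω → a.Val → b.Val} (hg : Computes datum b c g)
    (hf : Computes datum a b f) : Computes datum a c (fun A x => g A (f A x)) := by
  obtain ⟨p, hp⟩ := hg
  obtain ⟨q, hq⟩ := hf
  exact ⟨p.comp q, fun A x => by simp [Prog.eval, hp, hq]⟩

theorem id : Computes datum a a (fun _ x => x) := ⟨.id, fun _ _ => by simp [Prog.eval]⟩

theorem fst : Computes datum (.prod a b) a (fun _ (x : a.Val × b.Val) => x.1) :=
  ⟨.fst, fun _ _ => by simp [Prog.eval]⟩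

theorem snd : Computes datum (.prod a b) b (fun _ (x : a.Val × b.Val) => x.2) :=
  ⟨.snd, fun _ _ => by simp [Prog.eval]⟩

theorem pair {f : Ω → a.Val → b.Val} {g : Ω → a.Val → c.Val} (hf : Computes datum a b f)
    (hg : Computes datum a c g) : Computes datum a (.prod b c) (fun A x => (f A x, g A x)) := by
  obtain ⟨p, hp⟩ := hf
  obtain ⟨q, hq⟩ := hg
  exact ⟨p.pair q, fun A x => by simp [Prog.eval, hp, hq]⟩

theorem query (q : S.Query) : Computes datum (S.dom q) (S.cod q) (fun A x => datum A q x) :=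
  ⟨.query q, fun _ _ => by simp [Prog.eval]⟩

theorem nil : Computes datum a (.list b) (fun _ _ => []) :=
  ⟨.comp .nil .drop, fun _ _ => by simp [Prog.eval]⟩

theorem cons {f : Ω → a.Val → b.Val} {g : Ω → a.Val → List b.Val} (hf : Computes datum a b f)
    (hg : Computes datum a (.list b) g) :
    Computes datum a (.list b) (fun A x => f A x :: g A x) := by
  obtain ⟨p, hp⟩ := hf
  obtain ⟨q, hq⟩ := hg
  exact ⟨.comp .cons (p.pair q), fun A x => by simp [Prog.eval, hp, hq]⟩

theorem ite_zero {n : Ω → a.Val → ℕ} {f g : Ω → a.Val → b.Val} (hn : Computes datum a .nat n)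
    (hf : Computes datum a b f) (hg : Computes datum a b g) :
    Computes datum a b (fun A x => if n A x = 0 then f A x else g A x) := by
  obtain ⟨p, hp⟩ := hf
  obtain ⟨q, hq⟩ := hg
  obtain ⟨r, hr⟩ := hn
  refine ⟨.ifZero r p q, fun A x => ?_⟩
  rw [Prog.eval]
  dsimp only
  rw [hr, hp, hq, Part.bind_some]
  split_ifs <;> rfl

theorem natRec {n : Ω → a.Val → ℕ} {f : Ω → a.Val → b.Val} {g : Ω → a.Val × ℕ × b.Val → b.Val}
    (hf : Computes datum a b f) (hg : Computes datum (.prod a (.prod .nat b)) b g)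
    (hn : Computes datum a .nat n) :
    Computes datum a b
      (fun A x => Nat.rec (f A x) (fun k y => g A (x, (k, y))) (n A x)) := by
  obtain ⟨p, hp⟩ := hf
  obtain ⟨q, hq⟩ := hg
  have : Computes datum (.prod a .nat) b
      (fun A (x : a.Val × ℕ) => Nat.rec (f A x.1) (fun k y => g A (x.1, (k, y))) x.2) := by
    refine ⟨.natRec p q, fun A x => ?_⟩
    obtain ⟨x, n⟩ := x
    rw [Prog.eval]
    induction n with
    | zero => exact hp A x
    | succ k ih =>
      dsimp only at ih ⊢
      rw [ih, Part.bind_some, hq]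
  exact this.comp (id.pair hn)

theorem listRec {l : Ω → a.Val → List c.Val} {f : Ω → a.Val → b.Val}
    {g : Ω → a.Val × c.Val × List c.Val × b.Val → b.Val}
    (hf : Computes datum a b f)
    (hg : Computes datum (.prod a (.prod c (.prod (.list c) b))) b g)
    (hl : Computes datum a (.list c) l) :
    Computes datum a b
      (fun A x => List.rec (f A x) (fun h t y => g A (x, (h, (t, y)))) (l A x)) := by
  obtain ⟨p, hp⟩ := hf
  obtain ⟨q, hq⟩ := hg
  have : Computes datum (.prod a (.list c)) b
      (fun A (x : a.Val × List c.Val) =>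
        List.rec (f A x.1) (fun h t y => g A (x.1, (h, (t, y)))) x.2) := by
    refine ⟨.listRec p q, fun A x => ?_⟩
    obtain ⟨x, l⟩ := x
    rw [Prog.eval]
    induction l with
    | nil => exact hp A x
    | cons h t ih =>
      dsimp only at ih ⊢
      rw [ih, Part.bind_some, hq]
  exact this.comp (id.pair hl)

/-- A zero for every argument keeps the search total. Only the defining property of the value found
is exported; its minimality is never needed. -/
theorem exists_search {f : Ω → a.Val × ℕ → ℕ} (hf : Computes datum (.prod a .nat) .nat f)
    (h : ∀ A x, ∃ n, f A (x, n) = 0) :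
    ∃ g : Ω → a.Val → ℕ, Computes datum a .nat g ∧ ∀ A x, f A (x, g A x) = 0 := by
  obtain ⟨p, hp⟩ := hf
  refine ⟨fun A x => Nat.find (h A x), ⟨.search p, fun A x => ?_⟩,
    fun A x => Nat.find_spec (h A x)⟩
  rw [Prog.eval, Part.eq_some_iff]
  refine Nat.mem_rfind.2 ?_
  have hd (n : ℕ) : ((p.eval (datum A) (x, n)).map fun k : ℕ => decide (k = 0)) =
      Part.some (decide (f A (x, n) = 0)) := by
    rw [hp A (x, n)]
    exact Part.map_some _ _
  refine ⟨?_, fun {k} hk => ?_⟩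
  · rw [hd, Part.mem_some_iff, eq_comm, decide_eq_true_eq]
    exact Nat.find_spec (h A x)
  · rw [hd, Part.mem_some_iff, eq_comm, decide_eq_false_iff_not]
    exact Nat.find_min (h A x) hk

/-! ### Arithmetic -/

theorem nat_zero : Computes datum a .nat (fun _ _ => (0 : ℕ)) :=
  ⟨.comp .zero .drop, fun _ _ => by simp [Prog.eval]⟩

theorem nat_succ {n : Ω → a.Val → ℕ} (hn : Computes datum a .nat n) :
    Computes datum a .nat (fun A x => n A x + 1) := by
  obtain ⟨p, hp⟩ := hn
  exact ⟨.comp .succ p, fun A x => by simp [Prog.eval, hp]⟩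

theorem nat_const (k : ℕ) : Computes datum a .nat (fun _ _ => k) := by
  induction k with
  | zero => exact nat_zero
  | succ k ih => exact ih.nat_succ

theorem nat_pred {n : Ω → a.Val → ℕ} (hn : Computes datum a .nat n) :
    Computes datum a .nat (fun A x => n A x - 1) := by
  have h := natRec (b := .nat) (g := fun _ (x : a.Val × ℕ × ℕ) => x.2.1) (nat_zero)
    (fst.comp snd) hn
  convert h using 3 with A x
  cases n A x <;> rfl

theorem nat_add {k n : Ω → a.Val → ℕ} (hk : Computes datum a .nat k)
    (hn : Computes datum a .nat n) : Computes datum a .nat (fun A x => k A x + n A x) := by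
  have h := natRec (b := .nat) (g := fun _ (x : a.Val × ℕ × ℕ) => x.2.2 + 1) hk
    (nat_succ (snd.comp snd)) hn
  convert h using 3 with A x
  induction n A x with
  | zero => rfl
  | succ j ih => rw [← Nat.add_assoc, ih]

theorem nat_mul {k n : Ω → a.Val → ℕ} (hk : Computes datum a .nat k)
    (hn : Computes datum a .nat n) : Computes datum a .nat (fun A x => k A x * n A x) := by
  have h := natRec (b := .nat) (g := fun A (x : a.Val × ℕ × ℕ) => x.2.2 + k A x.1) nat_zero
    ((snd.comp snd).nat_add (hk.comp fst)) hn
  convert h using 3 with A x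
  induction n A x with
  | zero => rfl
  | succ j ih => rw [Nat.mul_succ, ih]

theorem real_zero : Computes datum a .real (fun _ _ => (0 : ℝ)) :=
  ⟨.comp .rzero .drop, fun _ _ => by simp [Prog.eval]⟩

theorem real_one : Computes datum a .real (fun _ _ => (1 : ℝ)) :=
  ⟨.comp .rone .drop, fun _ _ => by simp [Prog.eval]⟩

theorem add {f g : Ω → a.Val → ℝ} (hf : Computes datum a .real f)
    (hg : Computes datum a .real g) : Computes datum a .real (fun A x => f A x + g A x) := by
  obtain ⟨p, hp⟩ := hf
  obtain ⟨q, hq⟩ := hg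
  exact ⟨.comp .add (p.pair q), fun A x => by simp [Prog.eval, hp, hq]⟩

theorem mul {f g : Ω → a.Val → ℝ} (hf : Computes datum a .real f)
    (hg : Computes datum a .real g) : Computes datum a .real (fun A x => f A x * g A x) := by
  obtain ⟨p, hp⟩ := hf
  obtain ⟨q, hq⟩ := hg
  exact ⟨.comp .mul (p.pair q), fun A x => by simp [Prog.eval, hp, hq]⟩

theorem neg {f : Ω → a.Val → ℝ} (hf : Computes datum a .real f) :
    Computes datum a .real (fun A x => -f A x) := by
  obtain ⟨p, hp⟩ := hf
  exact ⟨.comp .neg p, fun A x => by simp [Prog.eval, hp]⟩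

theorem sub {f g : Ω → a.Val → ℝ} (hf : Computes datum a .real f)
    (hg : Computes datum a .real g) : Computes datum a .real (fun A x => f A x - g A x) := by
  simpa only [sub_eq_add_neg] using hf.add hg.neg

theorem sq {f : Ω → a.Val → ℝ} (hf : Computes datum a .real f) :
    Computes datum a .real (fun A x => f A x ^ 2) := by
  simpa only [pow_two] using hf.mul hf

theorem inv {f : Ω → a.Val → ℝ} (hf : Computes datum a .real f) (h : ∀ A x, f A x ≠ 0) :
    Computes datum a .real (fun A x => (f A x)⁻¹) := by
  obtain ⟨p, hp⟩ := hf
  exact ⟨.comp .inv p, fun A x => by simp [Prog.eval, hp, h]⟩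

open Classical in
theorem lt {f g : Ω → a.Val → ℝ} (hf : Computes datum a .real f)
    (hg : Computes datum a .real g) :
    Computes datum a .nat (fun A x => if f A x < g A x then (1 : ℕ) else 0) := by
  obtain ⟨p, hp⟩ := hf
  obtain ⟨q, hq⟩ := hg
  exact ⟨.comp .lt (p.pair q), fun A x => by simp [Prog.eval, hp, hq]⟩

open Classical in
theorem ite_lt {u v : Ω → a.Val → ℝ} {f g : Ω → a.Val → b.Val} (hu : Computes datum a .real u)
    (hv : Computes datum a .real v) (hf : Computes datum a b f) (hg : Computes datum a b g) :
    Computes datum a b (fun A x => if u A x < v A x then f A x else g A x) := by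
  convert ite_zero (hu.lt hv) hg hf using 3 with A x
  by_cases h : u A x < v A x <;> simp [h]

theorem natCast {n : Ω → a.Val → ℕ} (hn : Computes datum a .nat n) :
    Computes datum a .real (fun A x => (n A x : ℝ)) := by
  have h := natRec (b := .real) (g := fun _ (x : a.Val × ℕ × ℝ) => x.2.2 + 1) real_zero
    ((snd.comp snd).add real_one) hn
  convert h using 3 with A x
  induction n A x with
  | zero => simp
  | succ k ih => push_cast; rw [ih]

theorem sum_range {n : Ω → a.Val → ℕ} {f : Ω → a.Val × ℕ → ℝ}
    (hf : Computes datum (.prod a .nat) .real f) (hn : Computes datum a .nat n) :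
    Computes datum a .real (fun A x => ∑ i ∈ Finset.range (n A x), f A (x, i)) := by
  have h := natRec (b := .real)
    (g := fun A (x : a.Val × ℕ × ℝ) => x.2.2 + f A (x.1, x.2.1)) real_zero
    ((snd.comp snd).add (hf.comp (fst.pair (fst.comp snd)))) hn
  convert h using 3 with A x
  induction n A x with
  | zero => simp
  | succ k ih => rw [Finset.sum_range_succ, ih]

/-! ### Lists -/

theorem append {f g : Ω → a.Val → List b.Val} (hf : Computes datum a (.list b) f)
    (hg : Computes datum a (.list b) g) :
    Computes datum a (.list b) (fun A x => f A x ++ g A x) := by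
  have h := listRec (b := .list b)
    (g := fun _ (x : a.Val × b.Val × List b.Val × List b.Val) => x.2.1 :: x.2.2.2) hg
    (cons (fst.comp snd) (snd.comp (snd.comp snd))) hf
  convert h using 3 with A x
  induction f A x with
  | nil => rfl
  | cons y t ih => rw [List.cons_append, ih]

theorem flatMap {l : Ω → a.Val → List c.Val} {f : Ω → a.Val × c.Val → List b.Val}
    (hf : Computes datum (.prod a c) (.list b) f) (hl : Computes datum a (.list c) l) :
    Computes datum a (.list b) (fun A x => (l A x).flatMap fun y => f A (x, y)) := by
  have h := listRec (b := .list b)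
    (g := fun A (x : a.Val × c.Val × List c.Val × List b.Val) => f A (x.1, x.2.1) ++ x.2.2.2) nil
    (append (hf.comp (fst.pair (fst.comp snd))) (snd.comp (snd.comp snd))) hl
  convert h using 3 with A x
  induction l A x with
  | nil => rfl
  | cons y t ih => rw [List.flatMap_cons, ih]

/-- Lists are accessible only through recursion, so an entry is read by iterating the tail and
taking the head, with 0 past the end. -/
theorem getD {l : Ω → a.Val → List ℝ} {n : Ω → a.Val → ℕ} (hl : Computes datum a (.list .real) l)
    (hn : Computes datum a .nat n) :
    Computes datum a .real (fun A x => (l A x).getD (n A x) 0) := by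
  have htail : Computes datum (.list .real) (.list .real) (fun _ (l : List ℝ) => l.tail) := by
    have h := listRec (b := .list .real)
      (g := fun _ (x : List ℝ × ℝ × List ℝ × List ℝ) => x.2.2.1) nil
      (fst.comp (snd.comp snd)) (id (datum := datum) (a := .list .real))
    convert h using 3 with A l
    cases l <;> rfl
  have hhead : Computes datum (.list .real) .real (fun _ (l : List ℝ) => l.headD 0) := by
    have h := listRec (b := .real)
      (g := fun _ (x : List ℝ × ℝ × List ℝ × ℝ) => x.2.1) real_zero
      (fst.comp snd) (id (datum := datum) (a := .list .real))
    convert h using 3 with A l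
    cases l <;> rfl
  have h := natRec (b := .list .real)
    (g := fun _ (x : a.Val × ℕ × List ℝ) => x.2.2.tail) hl (htail.comp (snd.comp snd)) hn
  convert hhead.comp h using 3 with A x
  have key (k : ℕ) :
      (Nat.rec (l A x) (fun _ y => y.tail) k : List ℝ) = (l A x).drop k := by
    induction k with
    | zero => rfl
    | succ k ih =>
      dsimp only
      rw [ih, List.tail_drop]
  rw [key]
  simp [List.getD_eq_getElem?_getD, List.headD_eq_head?_getD]

end Computes

/-! ### Finite enumeration of candidates. -/

/-- The list of all vectors of length `n` with entries in the list `g`. -/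
def vectors (g : List ℝ) (n : ℕ) : List (List ℝ) :=
  Nat.rec [[]] (fun _ L => L.flatMap fun v => g.flatMap fun d => [d :: v]) n

theorem mem_vectors {g : List ℝ} {n : ℕ} {v : List ℝ} :
    v ∈ vectors g n ↔ v.length = n ∧ ∀ d ∈ v, d ∈ g := by
  induction n generalizing v with
  | zero =>
    change v ∈ [[]] ↔ _
    simp only [List.mem_singleton, List.length_eq_zero_iff]
    exact ⟨fun h => by simp [h], fun h => h.1⟩
  | succ n ih =>
    change v ∈ (vectors g n).flatMap (fun v => g.flatMap fun d => [d :: v]) ↔ _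
    simp only [List.mem_flatMap, List.mem_singleton, ih]
    constructor
    · rintro ⟨w, ⟨hw, hg⟩, d, hd, rfl⟩
      simpa [hw, hd] using hg
    · rintro ⟨hl, hg⟩
      obtain ⟨d, w, rfl⟩ := List.exists_cons_of_length_eq_add_one hl
      simp only [List.mem_cons, forall_eq_or_imp] at hg
      exact ⟨w, ⟨by simpa using hl, hg.2⟩, d, hg.1, rfl⟩

/-- The `n` points `f 0, …, f (n - 1)`, in reverse order. -/
def tabulate (f : ℕ → ℝ) (n : ℕ) : List ℝ := Nat.rec [] (fun k l => f k :: l) n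

theorem mem_tabulate {f : ℕ → ℝ} {n : ℕ} {x : ℝ} : x ∈ tabulate f n ↔ ∃ k < n, f k = x := by
  induction n with
  | zero => simp [tabulate]
  | succ n ih =>
    change x ∈ f n :: tabulate f n ↔ _
    rw [List.mem_cons, ih]
    constructor
    · rintro (rfl | ⟨k, hk, rfl⟩)
      exacts [⟨n, n.lt_succ_self, rfl⟩, ⟨k, hk.trans n.lt_succ_self, rfl⟩]
    · rintro ⟨k, hk, rfl⟩
      rcases Nat.lt_succ_iff_lt_or_eq.1 hk with h | rfl
      exacts [Or.inr ⟨k, h, rfl⟩, Or.inl rfl]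

namespace Computes

theorem vectors {g : Ω → a.Val → List ℝ} {n : Ω → a.Val → ℕ}
    (hg : Computes datum a (.list .real) g) (hn : Computes datum a .nat n) :
    Computes datum a (.list (.list .real)) (fun A x => RealRAM.vectors (g A x) (n A x)) := by
  have h1 : Computes datum (.prod (.prod a (.prod .nat (.list (.list .real)))) (.list .real))
      (.list (.list .real)) (fun A (y : (a.Val × ℕ × List (List ℝ)) × List ℝ) =>
        (g A y.1.1).flatMap fun d => [d :: y.2]) :=
    flatMap (a := .prod (.prod a (.prod .nat (.list (.list .real)))) (.list .real))
      (b := .list .real) (c := .real)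
      (l := fun A (y : (a.Val × ℕ × List (List ℝ)) × List ℝ) => g A y.1.1)
      (f := fun _ (y : ((a.Val × ℕ × List (List ℝ)) × List ℝ) × ℝ) => [y.2 :: y.1.2])
      (cons (cons snd (snd.comp fst)) nil) (hg.comp (fst.comp fst))
  have h2 : Computes datum (.prod a (.prod .nat (.list (.list .real)))) (.list (.list .real))
      (fun A (x : a.Val × ℕ × List (List ℝ)) =>
        x.2.2.flatMap fun v => (g A x.1).flatMap fun d => [d :: v]) :=
    flatMap (a := .prod a (.prod .nat (.list (.list .real))))
      (b := .list .real) (c := .list .real)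
      (l := fun _ (x : a.Val × ℕ × List (List ℝ)) => x.2.2) h1 (snd.comp snd)
  exact natRec (b := .list (.list .real)) (f := fun _ _ => [[]]) (cons nil nil) h2 hn

theorem tabulate {f : Ω → a.Val × ℕ → ℝ} {n : Ω → a.Val → ℕ}
    (hf : Computes datum (.prod a .nat) .real f) (hn : Computes datum a .nat n) :
    Computes datum a (.list .real) (fun A x => RealRAM.tabulate (fun k => f A (x, k)) (n A x)) :=
  natRec (b := .list .real) (g := fun A (x : a.Val × ℕ × List ℝ) => f A (x.1, x.2.1) :: x.2.2)
    nil (cons (hf.comp (fst.pair (fst.comp snd))) (snd.comp snd)) hn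

end Computes

end RealRAM

namespace Jacobi

/-! ### Approximate eigenvectors of self-adjoint operators. -/

section Operator

variable {H : Type*} [NormedAddCommGroup H] [InnerProductSpace ℂ H] [CompleteSpace H]

/-- The resolvent of a self-adjoint operator at a real point is self-adjoint, so its norm is its
spectral radius, the reciprocal of the distance to the spectrum. This turns a residual into an error
bound. -/
theorem exists_mem_spectrum_of_norm_sub_le {T : H →L[ℂ] H} (hT : IsSelfAdjoint T) {x η : ℝ}
    {v : H} (hv : v ≠ 0) (h : ‖T v - (x : ℂ) • v‖ ≤ η * ‖v‖) :
    ∃ z ∈ spectrum ℂ T, dist (x : ℂ) z ≤ η := by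
  have hv0 : 0 < ‖v‖ := norm_pos_iff.2 hv
  have hη : 0 ≤ η := by
    by_contra hη
    nlinarith [norm_nonneg (T v - (x : ℂ) • v)]
  by_cases hx : (x : ℂ) ∈ spectrum ℂ T
  · exact ⟨x, hx, by simpa using hη⟩
  rw [spectrum.notMem_iff] at hx
  obtain ⟨U, hU⟩ := hx
  have hUsa : IsSelfAdjoint (U : H →L[ℂ] H) := by
    rw [hU]
    refine IsSelfAdjoint.sub ?_ hT
    rw [IsSelfAdjoint, ← algebraMap_star_comm]
    simp
  have hRsa : IsSelfAdjoint ((U⁻¹ : (H →L[ℂ] H)ˣ) : H →L[ℂ] H) := by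
    have : IsSelfAdjoint U := Units.ext hUsa
    have h2 : IsSelfAdjoint U⁻¹ := this.inv
    exact congrArg Units.val h2
  have hle : ‖v‖ ≤ ‖((U⁻¹ : (H →L[ℂ] H)ˣ) : H →L[ℂ] H)‖ * (η * ‖v‖) := by
    have h1 : ((U⁻¹ : (H →L[ℂ] H)ˣ) : H →L[ℂ] H) ((U : H →L[ℂ] H) v) = v := by
      exact congrArg (fun S : H →L[ℂ] H => S v) U.inv_mul
    have h2 : (U : H →L[ℂ] H) v = -(T v - (x : ℂ) • v) := by
      rw [hU]
      simp [Algebra.algebraMap_eq_smul_one]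
    calc ‖v‖ = ‖((U⁻¹ : (H →L[ℂ] H)ˣ) : H →L[ℂ] H) ((U : H →L[ℂ] H) v)‖ := by rw [h1]
      _ ≤ _ * ‖(U : H →L[ℂ] H) v‖ := ContinuousLinearMap.le_opNorm _ _
      _ ≤ _ := by
        rw [h2, norm_neg]
        gcongr
  -- The resolvent has a spectral value `r` with `|r|` equal to its norm. Then `x - r⁻¹` lies in the
  -- spectrum of `T`, at distance `1 / |r| ≤ η` from `x`.
  have : Nontrivial H := ⟨v, 0, hv⟩
  obtain ⟨r, hr, hr'⟩ := spectrum.exists_nnnorm_eq_spectralRadius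
    (((U⁻¹ : (H →L[ℂ] H)ˣ) : H →L[ℂ] H))
  rw [hRsa.spectralRadius_eq_nnnorm, ENNReal.coe_inj] at hr'
  have hr'' : ‖r‖ = ‖((U⁻¹ : (H →L[ℂ] H)ˣ) : H →L[ℂ] H)‖ := congrArg NNReal.toReal hr'
  have hr0 : r ≠ 0 := by
    rintro rfl
    rw [← hr''] at hle
    simp at hle
    exact hv hle
  have hinv := (spectrum.inv_mem_iff (r := Units.mk0 r hr0) (a := U⁻¹)).1 hr
  rw [inv_inv, hU] at hinv
  have hmem : (x : ℂ) - r⁻¹ ∈ spectrum ℂ T := by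
    rw [spectrum.mem_iff] at hinv ⊢
    intro hu
    apply hinv
    rw [← IsUnit.neg_iff]
    convert hu using 1
    simp
    abel
  refine ⟨_, hmem, ?_⟩
  rw [dist_eq_norm, sub_sub_cancel, norm_inv, hr'', inv_le_iff_one_le_mul₀ (by
    rw [← hr'']; exact norm_pos_iff.2 hr0)]
  nlinarith

/-- Otherwise `x - T` is bounded below, hence injective with closed range; by self-adjointness the
orthogonal complement of the range is the kernel, so `x - T` is invertible. The strict inequality
forces `v ≠ 0`. -/
theorem exists_norm_sub_lt_of_mem_spectrum {T : H →L[ℂ] H} (hT : IsSelfAdjoint T) {x : ℝ}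
    (hx : (x : ℂ) ∈ spectrum ℂ T) {τ : ℝ} (hτ : 0 < τ) :
    ∃ v : H, ‖T v - (x : ℂ) • v‖ < τ * ‖v‖ := by
  by_contra! h
  apply spectrum.mem_iff.1 hx
  set U : H →L[ℂ] H := algebraMap ℂ (H →L[ℂ] H) x - T with hU
  have hUsa : IsSelfAdjoint U := by
    refine IsSelfAdjoint.sub ?_ hT
    rw [IsSelfAdjoint, ← algebraMap_star_comm]
    simp
  have hUv (v : H) : ‖U v‖ = ‖T v - (x : ℂ) • v‖ := by
    rw [← norm_neg, hU]
    simp [Algebra.algebraMap_eq_smul_one]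
  have hanti : AntilipschitzWith (τ.toNNReal)⁻¹ U := by
    refine U.antilipschitz_of_bound fun v => ?_
    rw [NNReal.coe_inv, Real.coe_toNNReal _ hτ.le, le_inv_mul_iff₀ hτ, hUv]
    exact h v
  rw [ContinuousLinearMap.isUnit_iff_bijective,
    ContinuousLinearMap.bijective_iff_dense_range_and_antilipschitz]
  refine ⟨?_, _, hanti⟩
  rw [Submodule.topologicalClosure_eq_top_iff, ContinuousLinearMap.orthogonal_range,
    ← ContinuousLinearMap.star_eq_adjoint, hUsa.star_eq]
  exact LinearMap.ker_eq_bot.2 hanti.injective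

end Operator

/-! ### Jacobi matrices acting on sequences -/

/-- The sequence `u` shifted by one place to the right. -/
def delay {R : Type*} [Zero R] (u : ℕ → R) : ℕ → R
  | 0 => 0
  | i + 1 => u i

/-- The Jacobi matrix with coefficients `α`, `β`, less `x` times the identity, applied to the
sequence `u`. -/
def apply {R : Type*} [CommRing R] (α β : ℕ → R) (x : R) (u : ℕ → R) (i : ℕ) : R :=
  -- In row 0 the index `i - 1` truncates to 0, but `delay u 0 = 0` removes the term.
  (α i - x) * u i + β i * u (i + 1) + β (i - 1) * delay u i

/-- A real matrix acts separately on real and imaginary parts, so a search over real vectors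
suffices. -/
theorem apply_ofReal (α β : ℕ → ℝ) (x : ℝ) (u v : ℕ → ℝ) (i : ℕ) :
    apply (fun k => (α k : ℂ)) (fun k => (β k : ℂ)) x (fun k => (u k : ℂ) + v k * Complex.I) i =
      apply α β x u i + apply α β x v i * Complex.I := by
  cases i <;> simp only [apply, delay] <;> push_cast <;> ring

theorem e_inner (i : ℕ) (v : Ell2) : inner ℂ (e i) v = v i := by
  rw [e, lp.inner_single_left]
  simp

theorem hasSum_smul_e (v : Ell2) : HasSum (fun j => (v j : ℂ) • e j) v := by
  have h := lp.hasSum_single (E := fun _ : ℕ => ℂ) (p := 2) (by norm_num) v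
  convert h using 2 with j
  rw [e, ← lp.single_smul]
  simp

theorem coe_sum_smul_e (u : ℕ → ℂ) (L i : ℕ) :
    ((∑ j ∈ Finset.range L, u j • e j : Ell2) : ℕ → ℂ) i = if i < L then u i else 0 := by
  rw [← e_inner, inner_sum]
  simp [inner_smul_right, e_inner, e_apply]

theorem norm_sq_eq_tsum (v : Ell2) : ‖v‖ ^ 2 = ∑' i, ‖v i‖ ^ 2 := by
  have h := lp.norm_rpow_eq_tsum (p := 2) (by norm_num) v
  simpa using h

theorem norm_sq_eq_sum (v : Ell2) {L : ℕ} (h : ∀ i, L ≤ i → v i = 0) :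
    ‖v‖ ^ 2 = ∑ i ∈ Finset.range L, ‖v i‖ ^ 2 := by
  rw [norm_sq_eq_tsum]
  refine tsum_eq_sum fun i hi => ?_
  rw [h i (by simpa using hi)]
  simp

variable {T : Ell2 →L[ℂ] Ell2} {a b : ℕ → ℝ}

/-- `T` and its adjoint have the same matrix entries, and a bounded operator is determined by its
values on the `e j`. -/
theorem HasTridiagonalMatrix.isSelfAdjoint (hT : HasTridiagonalMatrix T a b) :
    IsSelfAdjoint T := by
  have hb (j i : ℕ) : inner ℂ (e i) (ContinuousLinearMap.adjoint T (e j)) =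
      inner ℂ (e i) (T (e j)) := by
    rw [ContinuousLinearMap.adjoint_inner_right, ← inner_conj_symm, e_inner, e_inner, hT, hT]
    rcases lt_trichotomy i j with h | rfl | h
    · simp only [h.ne, h.ne', if_false]
      split_ifs <;> first | omega | simp
    · simp
    · simp only [h.ne, h.ne', if_false]
      split_ifs <;> first | omega | simp
  have he (j : ℕ) : ContinuousLinearMap.adjoint T (e j) = T (e j) := by
    ext i
    rw [← e_inner, ← e_inner, hb]
  rw [ContinuousLinearMap.isSelfAdjoint_iff']
  ext1 v
  have h1 := (hasSum_smul_e v).mapL (ContinuousLinearMap.adjoint T)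
  have h2 := (hasSum_smul_e v).mapL T
  simp only [map_smul, he] at h1 h2
  exact h1.unique h2

theorem HasTridiagonalMatrix.apply_sum (hT : HasTridiagonalMatrix T a b) (u : ℕ → ℂ) {L : ℕ}
    (hu : ∀ i, L ≤ i → u i = 0) (x : ℂ) (i : ℕ) :
    ((T (∑ j ∈ Finset.range L, u j • e j) - x • ∑ j ∈ Finset.range L, u j • e j : Ell2) :
      ℕ → ℂ) i = apply (fun k => (a k : ℂ)) (fun k => (b k : ℂ)) x u i := by
  rw [← e_inner, inner_sub_right, inner_smul_right, e_inner _ (∑ j ∈ _, _), coe_sum_smul_e,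
    map_sum, inner_sum]
  simp only [map_smul, inner_smul_right, e_inner, hT i]
  have h1 : ∀ j, u j * (if i = j then (a i : ℂ) else if j = i + 1 then (b i : ℂ) else
      if i = j + 1 then (b j : ℂ) else 0) = (if j = i then u i * a i else 0) +
      (if j = i + 1 then u (i + 1) * b i else 0) +
      (if j = i - 1 then (b (i - 1) : ℂ) * delay u i else 0) := by
    intro j
    cases i with
    | zero =>
      simp only [delay]
      split_ifs <;> simp_all
    | succ i =>
      simp only [delay]
      split_ifs <;> first | omega | (subst_vars; simp [mul_comm])
  simp only [h1, Finset.sum_add_distrib, Finset.sum_ite_eq', Finset.mem_range]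
  have h2 : ∀ i, (if i < L then u i else 0) = u i := fun i => by
    split_ifs with h
    · rfl
    · exact (hu i (by omega)).symm
  have h3 (c : ℂ) (i : ℕ) : (if i < L then u i * c else 0) = u i * c := by
    split_ifs with h
    · rfl
    · rw [hu i (by omega), zero_mul]
  have h4 : (if i - 1 < L then (b (i - 1) : ℂ) * delay u i else 0) = b (i - 1) * delay u i := by
    split_ifs with h
    · rfl
    · cases i with
      | zero => simp [delay]
      | succ i => simp only [delay]; rw [hu i (by simpa using h), mul_zero]
  rw [h2, h3, h3, h4, apply]
  ring

/-- A tridiagonal matrix enlarges the support by one place. Hence residuals are summed over `L + 1`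
rows, with nothing lost. -/
theorem apply_eq_zero {R : Type*} [CommRing R] {α β : ℕ → R} {x : R} {u : ℕ → R} {L : ℕ}
    (hu : ∀ i, L ≤ i → u i = 0) {i : ℕ} (hi : L + 1 ≤ i) : apply α β x u i = 0 := by
  obtain ⟨j, rfl⟩ : ∃ j, i = j + 1 := ⟨i - 1, by omega⟩
  simp only [apply, delay]
  rw [hu _ (by omega), hu _ (by omega), hu _ (by omega)]
  ring

theorem HasTridiagonalMatrix.exists_mem_spectrum (hT : HasTridiagonalMatrix T a b) {x η : ℝ}
    (hη : 0 ≤ η) (u : ℕ → ℂ) {L : ℕ} (hu : ∀ i, L ≤ i → u i = 0)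
    (hpos : 0 < ∑ i ∈ Finset.range L, ‖u i‖ ^ 2)
    (h : ∑ i ∈ Finset.range (L + 1),
        ‖apply (fun k => (a k : ℂ)) (fun k => (b k : ℂ)) x u i‖ ^ 2 ≤
      η ^ 2 * ∑ i ∈ Finset.range L, ‖u i‖ ^ 2) :
    ∃ z ∈ spectrum ℂ T, dist (x : ℂ) z ≤ η := by
  set v : Ell2 := ∑ j ∈ Finset.range L, u j • e j with hv
  have hvi (i : ℕ) : v i = u i := by
    rw [hv, coe_sum_smul_e]
    split_ifs with h
    · rfl
    · exact (hu i (by omega)).symm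
  have hn : ‖v‖ ^ 2 = ∑ i ∈ Finset.range L, ‖u i‖ ^ 2 := by
    rw [norm_sq_eq_sum v (L := L) (fun i hi => by rw [hvi, hu i hi])]
    simp only [hvi]
  have hn' := norm_sq_eq_sum (T v - (x : ℂ) • v) (L := L + 1) (fun i hi => by
    rw [hT.apply_sum u hu, apply_eq_zero hu hi])
  simp only [hv, hT.apply_sum u hu] at hn'
  rw [← hn'] at h
  refine exists_mem_spectrum_of_norm_sub_le (v := v) hT.isSelfAdjoint ?_ ?_
  · rintro h0
    rw [← hn, h0] at hpos
    simp at hpos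
  · rw [← hn, ← mul_pow] at h
    exact (sq_le_sq₀ (norm_nonneg _) (by positivity)).1 h

/-- Finitely supported vectors are dense and the strict residual inequality is an open condition, so
a truncation still satisfies it; then a real vector is extracted. -/
theorem HasTridiagonalMatrix.exists_approx_eigenvector (hT : HasTridiagonalMatrix T a b) {x : ℝ}
    (hx : (x : ℂ) ∈ spectrum ℂ T) {τ : ℝ} (hτ : 0 < τ) :
    ∃ (u : ℕ → ℝ) (L : ℕ), (∀ i, L ≤ i → u i = 0) ∧ 0 < ∑ i ∈ Finset.range L, u i ^ 2 ∧
      ∑ i ∈ Finset.range (L + 1), apply a b x u i ^ 2 ≤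
        τ ^ 2 * ∑ i ∈ Finset.range L, u i ^ 2 := by
  obtain ⟨w, hw⟩ := exists_norm_sub_lt_of_mem_spectrum hT.isSelfAdjoint hx hτ
  have hlim := (hasSum_smul_e w).tendsto_sum_nat
  have hopen : IsOpen {v : Ell2 | ‖T v - (x : ℂ) • v‖ < τ * ‖v‖} :=
    isOpen_lt (by fun_prop) (by fun_prop)
  obtain ⟨L, hL⟩ := (hlim.eventually (hopen.mem_nhds hw)).exists
  set u : ℕ → ℂ := fun i => if i < L then w i else 0 with hu
  have hu0 : ∀ i, L ≤ i → u i = 0 := fun i hi => by simp [hu, hi]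
  have hsum : (∑ j ∈ Finset.range L, (w j : ℂ) • e j : Ell2) =
      ∑ j ∈ Finset.range L, u j • e j :=
    Finset.sum_congr rfl fun j hj => by simp [hu, Finset.mem_range.1 hj]
  rw [hsum] at hL
  set v : Ell2 := ∑ j ∈ Finset.range L, u j • e j with hv
  have hvi (i : ℕ) : v i = u i := by
    rw [hv, coe_sum_smul_e]
    split_ifs with h
    · rfl
    · exact (hu0 i (by omega)).symm
  have hn : ‖v‖ ^ 2 = ∑ i ∈ Finset.range L, ‖u i‖ ^ 2 := by
    rw [norm_sq_eq_sum v (L := L) (fun i hi => by rw [hvi, hu0 i hi])]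
    simp only [hvi]
  have hn' := norm_sq_eq_sum (T v - (x : ℂ) • v) (L := L + 1) (fun i hi => by
    rw [hT.apply_sum u hu0, apply_eq_zero hu0 hi])
  simp only [hv, hT.apply_sum u hu0] at hn'
  have hL' := (sq_lt_sq₀ (norm_nonneg _) (by positivity)).2 hL
  rw [mul_pow, hn, hn'] at hL'
  have key (y z : ℝ) : ‖(y : ℂ) + z * Complex.I‖ ^ 2 = y ^ 2 + z ^ 2 := by
    rw [Complex.sq_norm, Complex.normSq_add_mul_I]
  have hui (i : ℕ) : u i = ((u i).re : ℂ) + (u i).im * Complex.I := (Complex.re_add_im _).symm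
  have happ (i : ℕ) : ‖apply (fun k => (a k : ℂ)) (fun k => (b k : ℂ)) x u i‖ ^ 2 =
      apply a b x (fun k => (u k).re) i ^ 2 + apply a b x (fun k => (u k).im) i ^ 2 := by
    rw [← key, ← apply_ofReal, ← funext hui]
  have hnorm (i : ℕ) : ‖u i‖ ^ 2 = (u i).re ^ 2 + (u i).im ^ 2 := by rw [hui, key]; simp
  simp only [happ, hnorm, Finset.sum_add_distrib] at hL'
  have hre1 := Finset.sum_nonneg (s := Finset.range (L + 1)) fun i _ =>
    sq_nonneg (apply a b x (fun k => (u k).re) i)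
  have him1 := Finset.sum_nonneg (s := Finset.range (L + 1)) fun i _ =>
    sq_nonneg (apply a b x (fun k => (u k).im) i)
  -- Both sides split into real and imaginary contributions, so at least one part satisfies the
  -- strict inequality, which also makes it nonzero.
  by_cases h : ∑ i ∈ Finset.range (L + 1), apply a b x (fun k => (u k).re) i ^ 2 <
      τ ^ 2 * ∑ i ∈ Finset.range L, (u i).re ^ 2
  · exact ⟨_, L, fun i hi => by simp [hu0 i hi], pos_of_mul_pos_right (hre1.trans_lt h)
      (by positivity), h.le⟩
  · have h' : ∑ i ∈ Finset.range (L + 1), apply a b x (fun k => (u k).im) i ^ 2 <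
      τ ^ 2 * ∑ i ∈ Finset.range L, (u i).im ^ 2 := by
      rw [mul_add] at hL'
      linarith
    exact ⟨_, L, fun i hi => by simp [hu0 i hi], pos_of_mul_pos_right (him1.trans_lt h')
      (by positivity), h'.le⟩

end Jacobi

namespace Jacobi

/-! ### Cutting off and rounding approximate eigenvectors. -/

section FiniteSums

variable {α β : ℕ → ℝ}

theorem sum_range_succ_shift_le {w : ℕ → ℝ} {L : ℕ} (hw : ∀ i, L ≤ i → w i = 0) :
    ∑ i ∈ Finset.range (L + 1), w (i + 1) ^ 2 ≤ ∑ i ∈ Finset.range L, w i ^ 2 := by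
  have h1 := Finset.sum_range_succ' (fun i => w i ^ 2) (L + 1)
  have h2 : ∑ i ∈ Finset.range (L + 2), w i ^ 2 = ∑ i ∈ Finset.range L, w i ^ 2 :=
    Finset.eventually_constant_sum (fun i hi => by rw [hw i hi]; ring) (by omega)
  rw [h2] at h1
  nlinarith [sq_nonneg (w 0)]

theorem sum_range_succ_delay (w : ℕ → ℝ) (L : ℕ) :
    ∑ i ∈ Finset.range (L + 1), delay w i ^ 2 = ∑ i ∈ Finset.range L, w i ^ 2 := by
  rw [Finset.sum_range_succ']
  simp [delay]

/-- The bound on `b` is asked for only when `y ≠ 0`, because later the coefficients are controlled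
only on the support of the vector. -/
theorem abs_mul_mul_le {b B y z : ℝ} (h : y ≠ 0 → |b| ≤ B) :
    |b * y * z| ≤ B * ((y ^ 2 + z ^ 2) / 2) ∨ y = 0 := by
  by_cases hy : y = 0
  · exact Or.inr hy
  · left
    have hb := h hy
    rw [mul_assoc, abs_mul, abs_mul]
    have : |y| * |z| ≤ (y ^ 2 + z ^ 2) / 2 := by
      nlinarith [sq_nonneg (|y| - |z|), sq_abs y, sq_abs z]
    exact mul_le_mul hb this (by positivity) ((abs_nonneg b).trans hb)

/-- A quadratic form bound: an approximate eigenvector of a Jacobi matrix with small coefficients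
cannot have a large approximate eigenvalue. -/
theorem abs_mul_sum_sq_le {A B t x : ℝ} (hB : 0 ≤ B) (ht : 0 < t) {w : ℕ → ℝ}
    {L : ℕ} (hw : ∀ i, L ≤ i → w i = 0) (hα : ∀ i, w i ≠ 0 → |α i| ≤ A)
    (hβ : ∀ i, w i ≠ 0 → |β i| ≤ B) :
    |x| * ∑ i ∈ Finset.range L, w i ^ 2 ≤
      (A + 2 * B + t / 2) * ∑ i ∈ Finset.range L, w i ^ 2 +
        (∑ i ∈ Finset.range (L + 1), apply α β x w i ^ 2) / (2 * t) := by
  -- Multiply row `i` by `w i` and solve for `x * w i ^ 2`. The products are bounded by the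
  -- arithmetic-geometric mean inequality, with weight `t` for the residual. After summation the `B`
  -- terms total `B + B / 2 + B / 2`.
  have hpt (i : ℕ) : |x| * w i ^ 2 ≤ (A + B + t / 2) * w i ^ 2 + B / 2 * w (i + 1) ^ 2 +
      B / 2 * delay w i ^ 2 + 1 / (2 * t) * apply α β x w i ^ 2 := by
    have h1 : |α i * w i ^ 2| ≤ A * w i ^ 2 := by
      by_cases hi : w i = 0
      · simp [hi]
      · rw [abs_mul, abs_of_nonneg (sq_nonneg (w i))]
        exact mul_le_mul_of_nonneg_right (hα i hi) (sq_nonneg _)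
    have h2 : |β i * w i * w (i + 1)| ≤ B * ((w i ^ 2 + w (i + 1) ^ 2) / 2) := by
      rcases abs_mul_mul_le (z := w (i + 1)) (hβ i) with h | h
      · exact h
      · rw [h]
        simpa using by positivity
    have h3 : |β (i - 1) * delay w i * w i| ≤ B * ((delay w i ^ 2 + w i ^ 2) / 2) := by
      have hd : delay w i ≠ 0 → |β (i - 1)| ≤ B := by
        cases i with
        | zero => simp [delay]
        | succ j => exact hβ j
      rcases abs_mul_mul_le (z := w i) hd with h | h
      · exact h
      · rw [h]
        simpa using by positivity
    have h4 : |apply α β x w i * w i| ≤ t / 2 * w i ^ 2 + 1 / (2 * t) * apply α β x w i ^ 2 := by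
      have h5 : 0 ≤ t / 2 * (|w i| - |apply α β x w i| / t) ^ 2 := by positivity
      have h6 : t / 2 * (|w i| - |apply α β x w i| / t) ^ 2 = t / 2 * |w i| ^ 2 +
          1 / (2 * t) * |apply α β x w i| ^ 2 - |apply α β x w i| * |w i| := by
        field_simp
        ring
      rw [abs_mul]
      rw [h6, sq_abs, sq_abs] at h5
      linarith
    have h7 : x * w i ^ 2 = α i * w i ^ 2 + β i * w i * w (i + 1) +
        β (i - 1) * delay w i * w i - apply α β x w i * w i := by
      simp only [apply]
      ring
    have h8 : |x| * w i ^ 2 = |x * w i ^ 2| := by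
      rw [abs_mul, abs_of_nonneg (sq_nonneg (w i))]
    rw [h8, h7]
    rw [abs_le] at *
    constructor <;> linarith [h1.1, h1.2, h2.1, h2.2, h3.1, h3.2, h4.1, h4.2]
  have hsum := Finset.sum_le_sum fun i (_ : i ∈ Finset.range (L + 1)) => hpt i
  simp only [Finset.sum_add_distrib, ← Finset.mul_sum] at hsum
  have h0 : ∑ i ∈ Finset.range (L + 1), w i ^ 2 = ∑ i ∈ Finset.range L, w i ^ 2 :=
    Finset.eventually_constant_sum (fun i hi => by rw [hw i hi]; ring) (by omega)
  rw [h0, sum_range_succ_delay] at hsum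
  have h1 := mul_le_mul_of_nonneg_left (sum_range_succ_shift_le hw) (by positivity : 0 ≤ B / 2)
  rw [div_eq_inv_mul _ (2 * t), ← one_div]
  linarith

/-- An approximate eigenvector for an approximate eigenvalue away from `[-1, 1]` can be cut off
at a place which depends on the tails of the coefficients only. -/
theorem exists_cutoff {ε x : ℝ} (hε : 0 < ε) (hε1 : ε ≤ 1) {m R L : ℕ}
    (hα : ∀ k, m ≤ k → |α k| ≤ ε) (hβ : ∀ k, m ≤ k → |β k| ≤ 1 / 2 + ε)
    (hx : 1 + 4 * ε ≤ |x|) (hR : 20 ≤ ε ^ 2 * R) (hL : m + R < L) {u : ℕ → ℝ}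
    (hu : ∀ i, L ≤ i → u i = 0) (hpos : 0 < ∑ i ∈ Finset.range L, u i ^ 2)
    (hres : R * ∑ i ∈ Finset.range (L + 1), apply α β x u i ^ 2 ≤
      1 / 2 * ∑ i ∈ Finset.range L, u i ^ 2) :
    ∃ (v : ℕ → ℝ) (k : ℕ), k ≤ m + R ∧ (∀ i, k ≤ i → v i = 0) ∧
      0 < ∑ i ∈ Finset.range k, v i ^ 2 ∧
      R * ∑ i ∈ Finset.range (k + 1), apply α β x v i ^ 2 ≤
        20 * ∑ i ∈ Finset.range k, v i ^ 2 := by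
  set S := ∑ i ∈ Finset.range L, u i ^ 2 with hS
  set F := ∑ i ∈ Finset.range (L + 1), apply α β x u i ^ 2 with hF
  have hR0 : (0 : ℝ) < R := by
    by_contra h
    nlinarith [sq_nonneg ε]
  -- Pigeonhole over `R` sites: the sum of `u j ^ 2 + u (j + 1) ^ 2` over all of them is at most `2
  -- * S`.
  obtain ⟨j, hjm, hjR, hj⟩ : ∃ j, m ≤ j ∧ j < m + R ∧
      R * (u j ^ 2 + u (j + 1) ^ 2) ≤ 2 * S := by
    by_contra! h
    have h1 : ∑ i ∈ Finset.Ico m (m + R), 2 * S <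
        ∑ i ∈ Finset.Ico m (m + R), R * (u i ^ 2 + u (i + 1) ^ 2) := by
      refine Finset.sum_lt_sum_of_nonempty ?_ fun i hi => ?_
      · rw [Finset.nonempty_Ico]
        have : 0 < R := by exact_mod_cast hR0
        omega
      · rw [Finset.mem_Ico] at hi
        exact h i hi.1 hi.2
    rw [← Finset.mul_sum (a := (R : ℝ)), Finset.sum_const, Nat.card_Ico, Nat.add_sub_cancel_left,
      nsmul_eq_mul] at h1
    have h2 : ∑ i ∈ Finset.Ico m (m + R), (u i ^ 2 + u (i + 1) ^ 2) ≤
        ∑ i ∈ Finset.range (L + 1), (u i ^ 2 + u (i + 1) ^ 2) :=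
      Finset.sum_le_sum_of_subset_of_nonneg
        (fun i hi => by rw [Finset.mem_Ico] at hi; rw [Finset.mem_range]; omega)
        (fun i _ _ => by positivity)
    rw [Finset.sum_add_distrib (s := Finset.range (L + 1))] at h2
    have h3 := sum_range_succ_shift_le hu
    have h4 : ∑ i ∈ Finset.range (L + 1), u i ^ 2 = S :=
      Finset.eventually_constant_sum (fun i hi => by rw [hu i hi]; ring) (by omega)
    have := lt_of_mul_lt_mul_left h1 hR0.le
    linarith
  set v : ℕ → ℝ := fun i => if i < j + 1 then u i else 0 with hv
  set w : ℕ → ℝ := fun i => if i < j + 1 then 0 else u i with hw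
  have hv0 : ∀ i, j + 1 ≤ i → v i = 0 := fun i hi => if_neg (by omega)
  have hw0 : ∀ i, L ≤ i → w i = 0 := fun i hi => by
    simp only [hw]
    rw [hu i hi, ite_self]
  have hadd : ∑ i ∈ Finset.range L, v i ^ 2 + ∑ i ∈ Finset.range L, w i ^ 2 = S := by
    rw [← Finset.sum_add_distrib]
    refine Finset.sum_congr rfl fun i _ => ?_
    simp only [hv, hw]
    split_ifs <;> ring
  have hb : β j ^ 2 ≤ 9 / 4 := by
    have := hβ j hjm
    rw [← sq_abs]
    nlinarith [abs_nonneg (β j)]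
  -- Cutting the bond between `j` and `j + 1` changes only these two rows, by `β j * u (j + 1)` and
  -- `β j * u j`. One majorant serves both pieces; its sum times `R` is at most `S + 2 * (9 / 4) * 2
  -- * S = 10 * S`.
  set E : ℕ → ℝ := fun i => 2 * apply α β x u i ^ 2 +
    ((if i = j then 2 * (β j ^ 2 * u (j + 1) ^ 2) else 0) +
      (if i = j + 1 then 2 * (β j ^ 2 * u j ^ 2) else 0)) with hE
  have hEsum : R * ∑ i ∈ Finset.range (L + 1), E i ≤ 10 * S := by
    simp only [hE, Finset.sum_add_distrib, ← Finset.mul_sum, Finset.sum_ite_eq',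
      Finset.mem_range]
    rw [if_pos (by omega), if_pos (by omega)]
    have h5 : β j ^ 2 * (R * (u j ^ 2 + u (j + 1) ^ 2)) ≤ 9 / 4 * (2 * S) :=
      mul_le_mul hb hj (by positivity) (by norm_num)
    linarith
  have hpt (i : ℕ) : apply α β x v i ^ 2 ≤ E i ∧ apply α β x w i ^ 2 ≤ E i := by
    have hfi := sq_nonneg (apply α β x u i)
    have hsq (p q : ℝ) : (p - q) ^ 2 ≤ 2 * p ^ 2 + 2 * q ^ 2 := by nlinarith [sq_nonneg (p + q)]
    rcases lt_trichotomy i j with h | rfl | h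
    · have h1 : apply α β x v i = apply α β x u i := by
        cases i with
        | zero => simp [apply, delay, hv, h.ne']
        | succ i =>
          simp only [apply, delay, hv]
          rw [if_pos (by omega), if_pos (by omega), if_pos (by omega)]
      have h2 : apply α β x w i = 0 := by
        cases i with
        | zero => simp [apply, delay, hw, h.ne']
        | succ i =>
          simp only [apply, delay, hw]
          rw [if_pos (by omega), if_pos (by omega), if_pos (by omega)]
          ring
      rw [h1, h2]
      simp only [hE, if_neg h.ne, if_neg (by omega : ¬ i = j + 1)]
      constructor <;> nlinarith
    · have h1 : apply α β x v i = apply α β x u i - β i * u (i + 1) := by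
        cases i with
        | zero => simp [apply, delay, hv]
        | succ i =>
          simp only [apply, delay, hv]
          rw [if_pos (by omega), if_neg (by omega), if_pos (by omega)]
          ring
      have h2 : apply α β x w i = β i * u (i + 1) := by
        cases i with
        | zero => simp [apply, delay, hw]
        | succ i =>
          simp only [apply, delay, hw]
          rw [if_pos (by omega), if_neg (by omega), if_pos (by omega)]
          ring
      rw [h1, h2]
      simp only [hE, if_true, if_neg (by omega : ¬ i = i + 1)]
      rw [← mul_pow]
      constructor
      · linarith [hsq (apply α β x u i) (β i * u (i + 1))]
      · nlinarith [sq_nonneg (β i * u (i + 1))]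
    · obtain ⟨i, rfl⟩ : ∃ i', i = i' + 1 := ⟨i - 1, by omega⟩
      by_cases hij : i = j
      · subst hij
        have h1 : apply α β x v (i + 1) = β i * u i := by
          simp [apply, delay, hv]
        have h2 : apply α β x w (i + 1) = apply α β x u (i + 1) - β i * u i := by
          simp [apply, delay, hw]
        rw [h1, h2]
        simp only [hE, if_true, if_neg (by omega : ¬ i + 1 = i)]
        rw [← mul_pow]
        constructor
        · nlinarith [sq_nonneg (β i * u i)]
        · linarith [hsq (apply α β x u (i + 1)) (β i * u i)]
      · have h1 : apply α β x v (i + 1) = 0 := by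
          simp only [apply, delay, hv]
          rw [if_neg (by omega), if_neg (by omega), if_neg (by omega)]
          ring
        have h2 : apply α β x w (i + 1) = apply α β x u (i + 1) := by
          simp only [apply, delay, hw]
          rw [if_neg (by omega), if_neg (by omega), if_neg (by omega)]
        rw [h1, h2]
        simp only [hE, if_neg h.ne', if_neg (by omega : ¬ i + 1 = j + 1)]
        constructor <;> nlinarith
  have hG : R * ∑ i ∈ Finset.range (L + 1), apply α β x v i ^ 2 ≤ 10 * S :=
    (mul_le_mul_of_nonneg_left (Finset.sum_le_sum fun i _ => (hpt i).1) hR0.le).trans hEsum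
  have hH : R * ∑ i ∈ Finset.range (L + 1), apply α β x w i ^ 2 ≤ 10 * S :=
    (mul_le_mul_of_nonneg_left (Finset.sum_le_sum fun i _ => (hpt i).2) hR0.le).trans hEsum
  have hwm (i : ℕ) (hi : w i ≠ 0) : m ≤ i := by
    by_contra hmi
    exact hi (by simp only [hw]; rw [if_pos (by omega)])
  -- With `A = ε`, `B = 1 / 2 + ε` and `t = ε` the form bound is `1 + 7 * ε / 2`, which leaves a gap
  -- of `ε / 2` below `|x|`.
  have hquad := abs_mul_sum_sq_le (x := x) (by positivity : 0 ≤ 1 / 2 + ε) hε hw0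
    (fun i hi => hα i (hwm i hi)) (fun i hi => hβ i (hwm i hi))
  set W := ∑ i ∈ Finset.range L, w i ^ 2 with hW
  set H := ∑ i ∈ Finset.range (L + 1), apply α β x w i ^ 2 with hHdef
  have hW0 : 0 ≤ W := Finset.sum_nonneg fun i _ => sq_nonneg _
  have hWH : ε ^ 2 * W ≤ H := by
    have h1 : (1 + 4 * ε) * W ≤ |x| * W := mul_le_mul_of_nonneg_right hx hW0
    have h2 : ε / 2 * W ≤ H / (2 * ε) := by linarith
    rw [le_div_iff₀ (by positivity)] at h2
    nlinarith
  -- This is where `20 ≤ ε ^ 2 * R` enters. The inner piece keeps mass at least `S / 2`, so `10 * S`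
  -- becomes at most 20 times its mass.
  have hWS : W ≤ S / 2 := by
    have h1 : R * (ε ^ 2 * W) ≤ 10 * S := (mul_le_mul_of_nonneg_left hWH hR0.le).trans hH
    have h2 : 20 * W ≤ ε ^ 2 * R * W := mul_le_mul_of_nonneg_right hR hW0
    linarith
  have hVk : ∑ i ∈ Finset.range L, v i ^ 2 = ∑ i ∈ Finset.range (j + 1), v i ^ 2 :=
    Finset.eventually_constant_sum (fun i hi => by rw [hv0 i hi]; ring) (by omega)
  have hGk : ∑ i ∈ Finset.range (L + 1), apply α β x v i ^ 2 =
      ∑ i ∈ Finset.range (j + 1 + 1), apply α β x v i ^ 2 :=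
    Finset.eventually_constant_sum (fun i hi => by rw [apply_eq_zero hv0 hi]; ring) (by omega)
  rw [hVk] at hadd
  rw [hGk] at hG
  exact ⟨v, j + 1, by omega, hv0, by linarith, by linarith⟩

theorem apply_smul {R : Type*} [CommRing R] (α β : ℕ → R) (x c : R) (u : ℕ → R) (i : ℕ) :
    apply α β x (fun k => c * u k) i = c * apply α β x u i := by
  cases i <;> simp only [apply, delay] <;> ring

/-- A unit approximate eigenvector remains one under small perturbations. -/
theorem perturb_approx_eigenvector {C x y δ : ℝ} {T : ℕ} (hT : 4 ≤ T)
    (hα : ∀ k, |α k| ≤ C) (hβ : ∀ k, |β k| ≤ C) {v v' : ℕ → ℝ} (hv : ∀ i, T ≤ i → v i = 0)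
    (hv' : ∀ i, T ≤ i → v' i = 0) (hx : |x| ≤ 3 * C + 1) (hxy : |y - x| ≤ 1 / T)
    (hvv' : ∀ i < T, |v' i - v i| ≤ 1 / T) (h1 : ∑ i ∈ Finset.range T, v i ^ 2 = 1)
    (hres : ∑ i ∈ Finset.range (T + 1), apply α β x v i ^ 2 ≤ δ) :
    1 / 4 ≤ ∑ i ∈ Finset.range T, v' i ^ 2 ∧
      ∑ i ∈ Finset.range (T + 1), apply α β y v' i ^ 2 ≤
        3 * (δ + 2 * (6 * C + 2) ^ 2 / T + 1 / T) := by
  have hT0 : (4 : ℝ) ≤ T := by exact_mod_cast hT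
  have hTpos : (0 : ℝ) < T := by linarith
  have hTinv : (1 : ℝ) / T ≤ 1 / 4 := one_div_le_one_div_of_le (by norm_num) hT0
  have hTinv0 : (0 : ℝ) < 1 / T := by positivity
  set d : ℕ → ℝ := fun i => v' i - v i with hd
  have hd1 (i : ℕ) : |d i| ≤ 1 / T := by
    by_cases hi : i < T
    · exact hvv' i hi
    · simp only [hd]
      rw [hv i (by omega), hv' i (by omega)]
      simp
  have hC : 0 ≤ C := (abs_nonneg _).trans (hα 0)
  have hsq {p q : ℝ} (h : |p| ≤ q) : p ^ 2 ≤ q ^ 2 := by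
    rw [← sq_abs]
    exact pow_le_pow_left₀ (abs_nonneg _) h 2
  constructor
  · have h2 : ∑ i ∈ Finset.range T, v i ^ 2 ≤
        ∑ i ∈ Finset.range T, (2 * v' i ^ 2 + 2 * (1 / T) ^ 2) := by
      refine Finset.sum_le_sum fun i _ => ?_
      have h3 := hsq (hd1 i)
      have h4 : v i = v' i - d i := by simp [hd]
      rw [h4]
      nlinarith [sq_nonneg (v' i + d i)]
    rw [Finset.sum_add_distrib, ← Finset.mul_sum, h1, Finset.sum_const, Finset.card_range,
      nsmul_eq_mul] at h2
    have h5 : (T : ℝ) * (2 * (1 / T) ^ 2) = 2 * (1 / T) := by field_simp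
    linarith
  · have hy : |y| ≤ 3 * C + 2 := by
      have := abs_add_le (y - x) x
      rw [sub_add_cancel] at this
      linarith
    -- The new residual is the old one, plus the matrix at `y` applied to the rounding error `d`,
    -- minus `(y - x) * v`. The factor `6 * C + 2` is `C + (3 * C + 2)` from the diagonal plus `2 *
    -- C` from the two neighbours.
    have hpt (i : ℕ) : apply α β y v' i ^ 2 ≤
        3 * apply α β x v i ^ 2 + 3 * ((6 * C + 2) * (1 / T)) ^ 2 + 3 * (1 / T) ^ 2 * v i ^ 2 := by
      have h2 : apply α β y v' i = apply α β x v i + apply α β y d i - (y - x) * v i := by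
        cases i <;> simp only [apply, delay, hd] <;> ring
      have h3 : |apply α β y d i| ≤ (6 * C + 2) * (1 / T) := by
        have hdel : |delay d i| ≤ 1 / T := by
          cases i with
          | zero => simp [delay]
          | succ i => exact hd1 i
        have e1 : |(α i - y) * d i| ≤ (C + (3 * C + 2)) * (1 / T) := by
          rw [abs_mul]
          exact mul_le_mul ((abs_sub _ _).trans (add_le_add (hα i) hy)) (hd1 i) (abs_nonneg _)
            (by positivity)
        have e2 : |β i * d (i + 1)| ≤ C * (1 / T) := by
          rw [abs_mul]
          exact mul_le_mul (hβ i) (hd1 _) (abs_nonneg _) hC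
        have e3 : |β (i - 1) * delay d i| ≤ C * (1 / T) := by
          rw [abs_mul]
          exact mul_le_mul (hβ _) hdel (abs_nonneg _) hC
        have := abs_add_three ((α i - y) * d i) (β i * d (i + 1)) (β (i - 1) * delay d i)
        rw [apply]
        linarith
      have h4 := hsq h3
      have h5 : ((y - x) * v i) ^ 2 ≤ (1 / T) ^ 2 * v i ^ 2 := by
        rw [mul_pow]
        exact mul_le_mul_of_nonneg_right (hsq hxy) (sq_nonneg _)
      rw [h2]
      nlinarith [sq_nonneg (apply α β x v i - apply α β y d i),
        sq_nonneg (apply α β x v i + (y - x) * v i), sq_nonneg (apply α β y d i + (y - x) * v i)]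
    have h6 := Finset.sum_le_sum fun i (_ : i ∈ Finset.range (T + 1)) => hpt i
    have h7 : ∑ i ∈ Finset.range (T + 1), v i ^ 2 = 1 := by
      rw [← h1]
      exact Finset.eventually_constant_sum (fun i hi => by rw [hv i hi]; ring) (by omega)
    simp only [Finset.sum_add_distrib, ← Finset.mul_sum, Finset.sum_const, Finset.card_range,
      nsmul_eq_mul, h7] at h6
    have h8 : ((T + 1 : ℕ) : ℝ) * (3 * ((6 * C + 2) * (1 / T)) ^ 2) ≤
        3 * (2 * (6 * C + 2) ^ 2 / T) := by
      have h9 : ((T + 1 : ℕ) : ℝ) ≤ 2 * T := by push_cast; linarith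
      calc ((T + 1 : ℕ) : ℝ) * (3 * ((6 * C + 2) * (1 / T)) ^ 2) ≤
          2 * T * (3 * ((6 * C + 2) * (1 / T)) ^ 2) :=
            mul_le_mul_of_nonneg_right h9 (by positivity)
        _ = _ := by field_simp
    have h10 : (1 / (T : ℝ)) ^ 2 ≤ 1 / T := by nlinarith
    linarith

end FiniteSums

end Jacobi

namespace Jacobi

/-! ### The spectrum inside and outside [-1, 1]. -/

section Spectrum

variable {T : Ell2 →L[ℂ] Ell2} {a b : ℕ → ℝ}

/-- The interval `[-1, 1]` lies in the spectrum if the coefficients converge to those of `Δ`. -/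
theorem HasTridiagonalMatrix.mem_spectrum_of_abs_le_one (hT : HasTridiagonalMatrix T a b)
    (htail : ∀ ε : ℝ, 0 < ε → ∃ m, ∀ k, m ≤ k → |a k| ≤ ε ∧ |b k - 1 / 2| ≤ ε) {x : ℝ}
    (hx : |x| ≤ 1) : (x : ℂ) ∈ spectrum ℂ T := by
  -- The spectrum is closed, so spectral points arbitrarily close to `x` suffice.
  rw [← (spectrum.isClosed T).closure_eq, Metric.mem_closure_iff]
  intro η₀ hη₀
  obtain ⟨η, hη0, hη1, hηη₀⟩ : ∃ η : ℝ, 0 < η ∧ η ≤ 1 ∧ η < η₀ :=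
    ⟨min 1 (η₀ / 2), by positivity, min_le_left _ _,
      (min_le_right _ _).trans_lt (half_lt_self hη₀)⟩
  obtain ⟨m, hm⟩ := htail (η / 4) (by positivity)
  -- The squared residual will be at most `9 * η ^ 2 * R / 16 + 64`; this `R` brings it below `η ^ 2
  -- * R`.
  obtain ⟨R, hR⟩ := exists_nat_gt (300 / η ^ 2)
  rw [div_lt_iff₀ (by positivity)] at hR
  have hR0 : 0 < R := by
    rcases Nat.eq_zero_or_pos R with rfl | h
    · norm_num at hR
    · exact h
  -- With `x = cos θ` this is `exp (iθ)`. The relation `z ^ 2 = 2 * x * z - 1` makes the powers of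
  -- `z` a bounded solution of the free eigenvalue equation in the interior.
  set z : ℂ := ⟨x, Real.sqrt (1 - x ^ 2)⟩ with hz
  have hs : Real.sqrt (1 - x ^ 2) ^ 2 = 1 - x ^ 2 :=
    Real.sq_sqrt (by nlinarith [sq_abs x, abs_nonneg x])
  have hz1 : ‖z‖ = 1 := by
    rw [← sq_eq_sq₀ (norm_nonneg _) zero_le_one, Complex.sq_norm, Complex.normSq_apply]
    simp only [hz]
    nlinarith
  have hz2 : z ^ 2 = 2 * x * z - 1 := by
    apply Complex.ext
    · simp only [hz, pow_two, Complex.mul_re, Complex.sub_re, Complex.one_re, Complex.mul_im,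
        Complex.ofReal_re, Complex.ofReal_im, Complex.re_ofNat, Complex.im_ofNat]
      simp only [pow_two] at hs
      linarith
    · simp only [hz, pow_two, Complex.mul_re, Complex.sub_im, Complex.one_im, Complex.mul_im,
        Complex.ofReal_re, Complex.ofReal_im, Complex.re_ofNat, Complex.im_ofNat]
      ring
  -- Row `M - 1` is the first one affected, and it involves `b (M - 2)`; the shift by 2 keeps that
  -- index at least `m`.
  set M := m + 2 with hM
  set u : ℕ → ℂ := fun i => if M ≤ i ∧ i < M + R then z ^ i else 0 with hu
  have hu0 : ∀ i, M + R ≤ i → u i = 0 := fun i hi => if_neg (by omega)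
  have huz : ∀ i, M ≤ i → i < M + R → u i = z ^ i := fun i h h' => if_pos ⟨h, h'⟩
  have hu1 (i : ℕ) : ‖u i‖ ≤ 1 := by
    simp only [hu]
    split_ifs
    · rw [norm_pow, hz1, one_pow]
    · simp
  have hnorm : ∑ i ∈ Finset.range (M + R), ‖u i‖ ^ 2 = R := by
    rw [Finset.range_eq_Ico, ← Finset.sum_Ico_consecutive _ (Nat.zero_le M) (Nat.le_add_right M R)]
    rw [Finset.sum_eq_zero, Finset.sum_congr rfl (g := fun _ => (1 : ℝ))]
    · simp
    · intro i hi
      rw [Finset.mem_Ico] at hi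
      rw [huz i hi.1 hi.2, norm_pow, hz1]
      norm_num
    · intro i hi
      rw [Finset.mem_Ico] at hi
      simp only [hu]
      rw [if_neg (by omega)]
      simp
  have hbound {i : ℕ} (hi : m ≤ i) : ‖(a i : ℂ)‖ ≤ 1 ∧ ‖(b i : ℂ)‖ ≤ 1 := by
    obtain ⟨h1, h2⟩ := hm i hi
    rw [Complex.norm_real, Complex.norm_real, Real.norm_eq_abs, Real.norm_eq_abs]
    refine ⟨by linarith, ?_⟩
    rw [abs_le] at h2 ⊢
    constructor <;> linarith [h2.1, h2.2]
  set g := apply (fun k => (a k : ℂ)) (fun k => (b k : ℂ)) x u with hg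
  have hmul {p q : ℂ} {r s : ℝ} (hp : ‖p‖ ≤ r) (hq : ‖q‖ ≤ s) : ‖p * q‖ ≤ r * s := by
    rw [norm_mul]
    exact mul_le_mul hp hq (norm_nonneg _) ((norm_nonneg _).trans hp)
  -- The window creates edge errors in four rows, each of squared size at most 16. Inside, only the
  -- deviations of the coefficients from those of `Δ` remain.
  have hpt (i : ℕ) : ‖g i‖ ^ 2 ≤ (if i ∈ Finset.Ico M (M + R) then 9 * (η / 4) ^ 2 else 0) +
      ((if i = M - 1 then 16 else 0) + (if i = M then 16 else 0) +
        (if i = M + R - 1 then 16 else 0) + (if i = M + R then 16 else 0)) := by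
    have hn1 : (0 : ℝ) ≤ if i ∈ Finset.Ico M (M + R) then 9 * (η / 4) ^ 2 else 0 := by
      split_ifs <;> positivity
    have hn2 (j : ℕ) : (0 : ℝ) ≤ if i = j then 16 else 0 := by split_ifs <;> norm_num
    by_cases hend : i = M - 1 ∨ i = M ∨ i = M + R - 1 ∨ i = M + R
    · have h16 : (16 : ℝ) ≤ (if i = M - 1 then 16 else 0) + (if i = M then 16 else 0) +
          (if i = M + R - 1 then 16 else 0) + (if i = M + R then 16 else 0) := by
        rcases hend with h | h | h | h
        · rw [if_pos h]
          linarith [hn2 M, hn2 (M + R - 1), hn2 (M + R)]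
        · rw [if_pos h]
          linarith [hn2 (M - 1), hn2 (M + R - 1), hn2 (M + R)]
        · rw [if_pos h]
          linarith [hn2 (M - 1), hn2 M, hn2 (M + R)]
        · rw [if_pos h]
          linarith [hn2 (M - 1), hn2 (M + R - 1), hn2 M]
      obtain ⟨j, rfl⟩ : ∃ j, i = j + 1 := ⟨i - 1, by omega⟩
      have hmj : m ≤ j := by omega
      have h1 : ‖((a (j + 1) : ℂ) - x) * u (j + 1)‖ ≤ 2 * 1 := by
        refine hmul ((norm_sub_le _ _).trans ?_) (hu1 _)
        have h2 := (hbound (hmj.trans j.le_succ)).1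
        rw [Complex.norm_real x, Real.norm_eq_abs]
        linarith
      have h2 := hmul (hbound (hmj.trans j.le_succ)).2 (hu1 (j + 1 + 1))
      have h3 := hmul (hbound hmj).2 (hu1 j)
      have h4 : ‖g (j + 1)‖ ≤ 4 := by
        rw [hg, apply]
        refine (norm_add₃_le).trans ?_
        simp only [Nat.add_sub_cancel, delay]
        linarith
      nlinarith [norm_nonneg (g (j + 1))]
    · push Not at hend
      by_cases hi : i ∈ Finset.Ico M (M + R)
      · have hn := add_nonneg (add_nonneg (add_nonneg (hn2 (M - 1)) (hn2 M)) (hn2 (M + R - 1)))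
          (hn2 (M + R))
        rw [if_pos hi]
        rw [Finset.mem_Ico] at hi
        obtain ⟨j, rfl⟩ : ∃ j, i = j + 1 := ⟨i - 1, by omega⟩
        have h1 : g (j + 1) = a (j + 1) * u (j + 1) + ((b (j + 1) - 1 / 2 : ℝ) : ℂ) * u (j + 2) +
            ((b j - 1 / 2 : ℝ) : ℂ) * u j := by
          have h2 : z ^ (j + 2) = 2 * x * z ^ (j + 1) - z ^ j := by
            rw [pow_add, hz2]
            ring
          simp only [hg, apply, Nat.add_sub_cancel, delay]
          rw [huz j (by omega) (by omega), huz (j + 1) (by omega) (by omega),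
            huz (j + 2) (by omega) (by omega), h2]
          push_cast
          ring
        have hab (k : ℕ) (hk : m ≤ k) : ‖(a k : ℂ)‖ ≤ η / 4 ∧
            ‖((b k - 1 / 2 : ℝ) : ℂ)‖ ≤ η / 4 := by
          rw [Complex.norm_real, Complex.norm_real]
          exact hm k hk
        have h3 : ‖g (j + 1)‖ ≤ 3 * (η / 4) := by
          rw [h1]
          refine (norm_add₃_le).trans ?_
          linarith [hmul (hab (j + 1) (by omega)).1 (hu1 (j + 1)),
            hmul (hab (j + 1) (by omega)).2 (hu1 (j + 2)), hmul (hab j (by omega)).2 (hu1 j)]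
        nlinarith [norm_nonneg (g (j + 1))]
      · have h1 : g i = 0 := by
          rw [Finset.mem_Ico] at hi
          simp only [hg, apply]
          have h2 : u i = 0 := if_neg (by omega)
          have h3 : u (i + 1) = 0 := if_neg (by omega)
          have h4 : delay u i = 0 := by
            cases i with
            | zero => rfl
            | succ j => exact if_neg (by omega)
          rw [h2, h3, h4]
          ring
        rw [h1, norm_zero]
        have := hn2 (M - 1)
        have := hn2 M
        have := hn2 (M + R - 1)
        have := hn2 (M + R)
        rw [zero_pow two_ne_zero]
        linarith
  have hsum : ∑ i ∈ Finset.range (M + R + 1), ‖g i‖ ^ 2 ≤ η ^ 2 * R := by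
    refine (Finset.sum_le_sum fun i _ => hpt i).trans ?_
    simp only [Finset.sum_add_distrib]
    rw [← Finset.sum_filter, Finset.filter_mem_eq_inter, Finset.inter_eq_right.2 (by
      intro i hi
      rw [Finset.mem_Ico] at hi
      rw [Finset.mem_range]
      omega)]
    simp only [Finset.sum_const, Nat.card_Ico, Finset.sum_ite_eq', Finset.mem_range, nsmul_eq_mul,
      Nat.add_sub_cancel_left]
    rw [if_pos (by omega), if_pos (by omega), if_pos (by omega), if_pos (by omega)]
    nlinarith
  obtain ⟨w, hw, hd⟩ := hT.exists_mem_spectrum hη0.le u hu0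
    (by rw [hnorm]; exact_mod_cast hR0) (by rw [hnorm]; exact hsum)
  exact ⟨w, hw, hd.trans_lt hηη₀⟩

theorem HasTridiagonalMatrix.exists_ofReal_eq (hT : HasTridiagonalMatrix T a b) {z : ℂ}
    (hz : z ∈ spectrum ℂ T) : ∃ x : ℝ, z = x :=
  ⟨z.re, hT.isSelfAdjoint.mem_spectrum_eq_re hz⟩

/-- The points of the grid of width `1 / T` in `[-T, T]`. -/
noncomputable def gridPoint (T k : ℕ) : ℝ := k * (T : ℝ)⁻¹ - T

theorem exists_gridPoint {T : ℕ} (hT : 0 < T) {x : ℝ} (hx : |x| ≤ T) :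
    ∃ k < 2 * (T * T) + 1, |gridPoint T k - x| ≤ 1 / T := by
  have hT0 : (0 : ℝ) < T := by exact_mod_cast hT
  rw [abs_le] at hx
  have h0 : 0 ≤ (x + T) * T := mul_nonneg (by linarith) hT0.le
  refine ⟨⌊(x + T) * T⌋₊, ?_, ?_⟩
  · rw [Nat.lt_succ_iff]
    apply Nat.floor_le_of_le
    push_cast
    nlinarith
  · have h1 := Nat.floor_le h0
    have h2 := Nat.lt_floor_add_one ((x + T) * T)
    have h3 : x + T = (x + T) * T * (T : ℝ)⁻¹ := by field_simp
    have h4 : (0 : ℝ) < (T : ℝ)⁻¹ := by positivity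
    rw [gridPoint, one_div, abs_le]
    constructor <;> nlinarith

/-- A point of the spectrum away from `[-1, 1]` is an approximate eigenvalue for a unit vector whose
support is bounded in terms of the tails of the coefficients only. -/
theorem HasTridiagonalMatrix.exists_unit_approx_eigenvector (hT : HasTridiagonalMatrix T a b)
    {m R N : ℕ} {ε x : ℝ} (hε : 0 < ε) (hε1 : ε ≤ 1) (hx : (x : ℂ) ∈ spectrum ℂ T)
    (ham : ∀ k, m ≤ k → |a k| ≤ ε) (hbm : ∀ k, m ≤ k → |b k| ≤ 1 / 2 + ε)
    (hx1 : 1 + 4 * ε ≤ |x|) (hR : 20 ≤ ε ^ 2 * R) (hN : m + R ≤ N) :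
    ∃ s : ℕ → ℝ, (∀ i, N ≤ i → s i = 0) ∧ ∑ i ∈ Finset.range N, s i ^ 2 = 1 ∧
      R * ∑ i ∈ Finset.range (N + 1), apply a b x s i ^ 2 ≤ 20 := by
  have hR0 : (0 : ℝ) < R := by
    by_contra h
    nlinarith [sq_nonneg ε]
  -- This tolerance is the residual bound demanded by `exists_cutoff`. The support is then padded
  -- beyond `m + R` so that the cut site lies within it.
  have hτ : 0 < Real.sqrt (1 / (2 * R)) := by positivity
  obtain ⟨u, L, hu, hpos, hres⟩ := hT.exists_approx_eigenvector hx hτ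
  rw [Real.sq_sqrt (by positivity)] at hres
  have hL1 : ∑ i ∈ Finset.range (L + m + R + 1), u i ^ 2 = ∑ i ∈ Finset.range L, u i ^ 2 :=
    Finset.eventually_constant_sum (fun i hi => by rw [hu i hi]; ring) (by omega)
  have hL2 : ∑ i ∈ Finset.range (L + m + R + 1 + 1), apply a b x u i ^ 2 =
      ∑ i ∈ Finset.range (L + 1), apply a b x u i ^ 2 :=
    Finset.eventually_constant_sum (fun i hi => by rw [apply_eq_zero hu hi]; ring) (by omega)
  rw [← hL1, ← hL2] at hres
  rw [← hL1] at hpos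
  obtain ⟨v, k, hk, hv, hvpos, hvres⟩ := exists_cutoff (R := R) hε hε1 ham hbm hx1
    hR (by omega : m + R < L + m + R + 1) (fun i hi => hu i (by omega)) hpos (by
      have := mul_le_mul_of_nonneg_left hres hR0.le
      refine this.trans_eq ?_
      field_simp)
  have hV1 : ∑ i ∈ Finset.range N, v i ^ 2 = ∑ i ∈ Finset.range k, v i ^ 2 :=
    Finset.eventually_constant_sum (fun i hi => by rw [hv i hi]; ring) (by omega)
  have hV2 : ∑ i ∈ Finset.range (N + 1), apply a b x v i ^ 2 =
      ∑ i ∈ Finset.range (k + 1), apply a b x v i ^ 2 :=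
    Finset.eventually_constant_sum (fun i hi => by rw [apply_eq_zero hv hi]; ring) (by omega)
  rw [← hV1, ← hV2] at hvres
  rw [← hV1] at hvpos
  set V := ∑ i ∈ Finset.range N, v i ^ 2 with hV
  set c : ℝ := (Real.sqrt V)⁻¹ with hc
  have hcV : c ^ 2 * V = 1 := by
    rw [hc, inv_pow, Real.sq_sqrt hvpos.le]
    exact inv_mul_cancel₀ hvpos.ne'
  refine ⟨fun i => c * v i, fun i hi => by simp [hv i (by omega)], ?_, ?_⟩
  · simp only [mul_pow, ← Finset.mul_sum]
    exact hcV
  · simp only [apply_smul, mul_pow, ← Finset.mul_sum]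
    have h1 := mul_le_mul_of_nonneg_left hvres (sq_nonneg c)
    linarith

/-- Completeness of the search: a point of the spectrum away from `[-1, 1]` is close to a grid
point which is an approximate eigenvalue for a vector with entries in the grid. -/
theorem HasTridiagonalMatrix.exists_grid_eigenvector (hT : HasTridiagonalMatrix T a b)
    {m R N : ℕ} {C ε x : ℝ} (hε : 0 < ε) (hε1 : ε ≤ 1) (hC : 1 ≤ C)
    (hx : (x : ℂ) ∈ spectrum ℂ T) (ha : ∀ k, |a k| ≤ C) (hb : ∀ k, |b k| ≤ C)
    (ham : ∀ k, m ≤ k → |a k| ≤ ε) (hbm : ∀ k, m ≤ k → |b k| ≤ 1 / 2 + ε)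
    (hx1 : 1 + 4 * ε ≤ |x|) (hR : 1000 ≤ ε ^ 2 * R) (hNR : m + R ≤ N)
    (hNC : 100 * (6 * C + 2) ^ 2 ≤ ε ^ 2 * N) :
    ∃ y : ℝ, (∃ k < 2 * (N * N) + 1, gridPoint N k = y) ∧ |y - x| ≤ ε ∧
      ∃ v : ℕ → ℝ, (∀ i, N ≤ i → v i = 0) ∧
        (∀ i < N, ∃ k < 2 * (N * N) + 1, gridPoint N k = v i) ∧
        0 < ∑ i ∈ Finset.range N, v i ^ 2 ∧
        ∑ i ∈ Finset.range (N + 1), apply a b y v i ^ 2 ≤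
          ε ^ 2 * ∑ i ∈ Finset.range N, v i ^ 2 := by
  have hεsq : ε ^ 2 ≤ 1 := pow_le_one₀ hε.le hε1
  have hN0 : (0 : ℝ) < N := by
    by_contra h
    nlinarith [sq_nonneg ε]
  have hNC' : 100 * (6 * C + 2) ^ 2 ≤ N :=
    hNC.trans (mul_le_of_le_one_left hN0.le hεsq)
  have h6C : 6 * C + 2 ≤ (6 * C + 2) ^ 2 := by nlinarith
  have hN4 : 4 ≤ N := by
    have : ((4 : ℕ) : ℝ) ≤ N := by push_cast; linarith
    exact_mod_cast this
  obtain ⟨s, hs0, hs1, hs2⟩ := hT.exists_unit_approx_eigenvector hε hε1 hx ham hbm hx1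
    (by linarith) hNR
  have hs3 : ∑ i ∈ Finset.range (N + 1), apply a b x s i ^ 2 ≤ ε ^ 2 / 50 := by
    have h0 : 0 ≤ ∑ i ∈ Finset.range (N + 1), apply a b x s i ^ 2 :=
      Finset.sum_nonneg fun i _ => sq_nonneg _
    have h1 := mul_le_mul_of_nonneg_left hs2 (sq_nonneg ε)
    rw [← mul_assoc] at h1
    linarith [mul_le_mul_of_nonneg_right hR h0]
  have hsle (i : ℕ) : |s i| ≤ 1 := by
    by_cases hi : i < N
    · have h1 := Finset.single_le_sum (f := fun i => s i ^ 2) (fun j _ => sq_nonneg (s j))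
        (Finset.mem_range.2 hi)
      rw [hs1] at h1
      exact abs_le_one_iff_mul_self_le_one.2 (by rw [← pow_two]; exact h1)
    · rw [hs0 i (by omega)]
      simp
  -- The form bound with `t = 1` gives `3 * C + 1 / 2` plus half the residual.
  have hxC : |x| ≤ 3 * C + 1 := by
    have h1 := abs_mul_sum_sq_le (x := x) (A := C) (by linarith : 0 ≤ C) one_pos hs0
      (fun i _ => ha i) (fun i _ => hb i)
    rw [hs1] at h1
    linarith
  obtain ⟨k₀, hk₀, hy⟩ := exists_gridPoint (T := N) (by omega) (x := x) (by linarith)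
  have hgrid (i : ℕ) := exists_gridPoint (T := N) (by omega) (x := s i)
    ((hsle i).trans (by exact_mod_cast (by omega : 1 ≤ N)))
  choose κ hκ hκ' using hgrid
  have hN1 : 1 / (N : ℝ) ≤ ε ^ 2 / 100 := by
    rw [div_le_iff₀ hN0]
    linarith
  obtain ⟨h1, h2⟩ := perturb_approx_eigenvector hN4 ha hb hs0
    (v' := fun i => if i < N then gridPoint N (κ i) else 0)
    (fun i hi => if_neg (by omega)) hxC hy
    (fun i hi => by simp only [if_pos hi]; exact hκ' i) hs1 hs3
  refine ⟨_, ⟨k₀, hk₀, rfl⟩, hy.trans (hN1.trans ?_), _, fun i hi => if_neg (by omega),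
    fun i hi => ⟨κ i, hκ i, (if_pos hi).symm⟩, by linarith, h2.trans ?_⟩
  · linarith [pow_le_of_le_one hε.le hε1 two_ne_zero]
  -- The rounded residual is at most `3 * (ε ^ 2 / 50 + ε ^ 2 / 50 + ε ^ 2 / 100)`, below the `ε ^ 2
  -- / 4` guaranteed by the norm bound; this accounts for the constants 1000 and 100.
  · have h3 : 2 * (6 * C + 2) ^ 2 / N ≤ ε ^ 2 / 50 := by
      rw [div_le_iff₀ hN0]
      linarith
    have h4 := mul_le_mul_of_nonneg_left h1 (sq_nonneg ε)
    linarith [sq_nonneg ε]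

end Spectrum

end Jacobi

namespace Jacobi

open RealRAM

/-! ### The approximation scheme and its error bounds. -/

namespace Input

variable (A : Input)

/-- A real `⨆` over an unbounded family is 0 by convention. Boundedness of `J` rules this out, so
the modulus does control individual coefficients. -/
theorem exists_abs_le : ∃ c : ℝ, ∀ k, |A.α k| ≤ c ∧ |A.β k| ≤ c := by
  have hJ (i j : ℕ) : ‖(A.J (e j) : ℕ → ℂ) i‖ ≤ ‖A.J‖ := by
    refine (lp.norm_apply_le_norm two_ne_zero _ i).trans ?_
    have h := A.J.le_opNorm (e j)
    rwa [e, lp.norm_single (by norm_num), norm_one, mul_one] at h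
  refine ⟨‖A.J‖, fun k => ⟨?_, ?_⟩⟩
  · have h := hJ k k
    rw [A.J_matrix] at h
    simpa using h
  · have h := hJ k (k + 1)
    rw [A.J_matrix] at h
    simpa using h

theorem tail_lt {ε : ℝ} (hε : 0 < ε) {k : ℕ} (hk : A.M ε ≤ k) :
    |A.α k| < ε ∧ |A.β k - 1 / 2| < ε := by
  obtain ⟨c, hc⟩ := A.exists_abs_le
  have h1 : |A.α k| ≤ ⨆ k : Set.Ici (A.M ε), |A.α k| :=
    le_ciSup (f := fun k : Set.Ici (A.M ε) => |A.α k|)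
      ⟨c, by rintro _ ⟨i, rfl⟩; exact (hc i).1⟩ ⟨k, hk⟩
  have h2 : |A.β k - 1 / 2| ≤ ⨆ k : Set.Ici (A.M ε), |A.β k - 1 / 2| :=
    le_ciSup (f := fun k : Set.Ici (A.M ε) => |A.β k - 1 / 2|)
      ⟨c + 1 / 2, by
        rintro _ ⟨i, rfl⟩
        refine (abs_sub _ _).trans ?_
        rw [abs_of_pos (by norm_num : (0 : ℝ) < 1 / 2)]
        linarith [(hc i).2]⟩ ⟨k, hk⟩
  have h := A.M_spec ε hε
  constructor <;> linarith [abs_nonneg (A.α k), abs_nonneg (A.β k - 1 / 2)]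

/-- The place after which the coefficients are within `1 / (n + 1)` of those of `Δ`. -/
noncomputable def cut (n : ℕ) : ℕ := A.M ((n : ℝ) + 1)⁻¹

/-- A bound for the coefficients. -/
noncomputable def bound (n : ℕ) : ℝ :=
  1 + 1 + ∑ k ∈ Finset.range (A.cut n), (A.α k ^ 2 + A.β k ^ 2)

theorem two_le_bound (n : ℕ) : 2 ≤ A.bound n := by
  have : 0 ≤ ∑ k ∈ Finset.range (A.cut n), (A.α k ^ 2 + A.β k ^ 2) :=
    Finset.sum_nonneg fun k _ => by positivity
  rw [bound]
  linarith

/-- Before the cut, `|t| ≤ 1 + t ^ 2`; after it, the coefficients are within 1 of 0 and 1/2.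
Finitely many queries thus bound them all. -/
theorem abs_le_bound (n k : ℕ) : |A.α k| ≤ A.bound n ∧ |A.β k| ≤ A.bound n := by
  by_cases hk : k < A.cut n
  · have h1 : A.α k ^ 2 + A.β k ^ 2 ≤ ∑ k ∈ Finset.range (A.cut n), (A.α k ^ 2 + A.β k ^ 2) :=
      Finset.single_le_sum (f := fun k => A.α k ^ 2 + A.β k ^ 2) (fun j _ => by positivity)
        (Finset.mem_range.2 hk)
    rw [bound]
    constructor <;>
      nlinarith [sq_nonneg (|A.α k| - 1), sq_nonneg (|A.β k| - 1), sq_abs (A.α k), sq_abs (A.β k)]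
  · have hn : ((n : ℝ) + 1)⁻¹ ≤ 1 := inv_le_one_of_one_le₀ (by linarith [n.cast_nonneg (α := ℝ)])
    obtain ⟨h1, h2⟩ := A.tail_lt (by positivity : 0 < ((n : ℝ) + 1)⁻¹) (not_lt.1 hk)
    have h3 := A.two_le_bound n
    refine ⟨by linarith, ?_⟩
    rw [abs_lt] at h2
    rw [abs_le]
    constructor <;> linarith [h2.1, h2.2]

/-- A lower bound for the size of the grid which makes the search complete. -/
noncomputable def threshold (n : ℕ) : ℝ :=
  -- The first two terms give room for `cut + R` sites with `R = 1000 * (n + 1) ^ 2`; the last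
  -- controls rounding. Numerals are cast from `ℕ` to match the program that computes them.
  A.cut n + (1000 : ℕ) * ((n : ℝ) + 1) ^ 2 +
    (100 : ℕ) * (((6 : ℕ) * A.bound n + (2 : ℕ)) * (n + 1)) ^ 2

theorem abs_le_one_mem_spectrum {x : ℝ} (hx : |x| ≤ 1) : (x : ℂ) ∈ _root_.spectrum ℂ A.J :=
  A.J_matrix.mem_spectrum_of_abs_le_one
    (fun ε hε => ⟨A.M ε, fun _ hk => ⟨(A.tail_lt hε hk).1.le, (A.tail_lt hε hk).2.le⟩⟩) hx

/-- The squared norm of the vector with the given list of entries. -/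
def normSq (N : ℕ) (v : List ℝ) : ℝ := ∑ i ∈ Finset.range N, v.getD i 0 ^ 2

/-- The squared norm of `(J - y) v`. -/
def residual (N : ℕ) (y : ℝ) (v : List ℝ) : ℝ :=
  ∑ i ∈ Finset.range (N + 1), apply A.α A.β y (fun i => v.getD i 0) i ^ 2

/-- The grid of width `1 / N` in `[-N, N]`. -/
noncomputable def grid (N : ℕ) : List ℝ := tabulate (gridPoint N) (2 * (N * N) + 1)

open Classical in
/-- The interval `[-1, 1]`, together with all points of the grid which are approximate
eigenvalues for some vector with entries in the grid. -/
noncomputable def approximation (size : ℕ → ℕ) (n : ℕ) : List (ℝ × ℝ) :=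
  (-1, 1) :: (grid (size n)).flatMap fun y =>
    (vectors (grid (size n)) (size n)).flatMap fun v =>
      -- The zero vector would pass the residual test at every grid point, so it is excluded.
      if 0 < normSq (size n) v then
        if ((n : ℝ) + 1)⁻¹ ^ 2 * normSq (size n) v < A.residual (size n) y v then [] else [(y, y)]
      else []

theorem mem_approximation {size : ℕ → ℕ} {n : ℕ} {p : ℝ × ℝ} :
    p ∈ A.approximation size n ↔ p = (-1, 1) ∨
      ∃ y ∈ grid (size n), ∃ v ∈ vectors (grid (size n)) (size n), 0 < normSq (size n) v ∧
        A.residual (size n) y v ≤ ((n : ℝ) + 1)⁻¹ ^ 2 * normSq (size n) v ∧ p = (y, y) := by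
  rw [approximation, List.mem_cons]
  simp only [List.mem_flatMap]
  refine or_congr_right (exists_congr fun y => and_congr_right fun _ => exists_congr fun v =>
    and_congr_right fun _ => ?_)
  split_ifs with h1 h2
  · simp only [List.not_mem_nil, false_iff]
    exact fun h => not_lt.2 h.2.1 h2
  · rw [List.mem_singleton]
    exact ⟨fun h => ⟨h1, not_lt.1 h2, h⟩, fun h => h.2.2⟩
  · simp only [List.not_mem_nil, false_iff]
    exact fun h => h1 h.1

/-- Soundness needs no lower bound on the grid size: each accepted point comes with a vector that
certifies it. -/
theorem exists_mem_spectrum_of_mem_approximation {size : ℕ → ℕ} {n : ℕ} {p : ℝ × ℝ}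
    (hp : p ∈ A.approximation size n) {x : ℝ} (h1 : p.1 ≤ x) (h2 : x ≤ p.2) :
    ∃ z ∈ _root_.spectrum ℂ A.J, dist (x : ℂ) z ≤ ((n : ℝ) + 1)⁻¹ := by
  have hn : 0 < ((n : ℝ) + 1)⁻¹ := by positivity
  rcases A.mem_approximation.1 hp with rfl | ⟨y, -, v, hv, hpos, hres, rfl⟩
  · exact ⟨x, A.abs_le_one_mem_spectrum (abs_le.2 ⟨h1, h2⟩), by simpa using hn.le⟩
  · obtain rfl : x = y := le_antisymm h2 h1
    have hcast (i : ℕ) : ‖apply (fun k => (A.α k : ℂ)) (fun k => (A.β k : ℂ)) x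
        (fun i => ((v.getD i 0 : ℝ) : ℂ)) i‖ ^ 2 =
        apply A.α A.β x (fun i => v.getD i 0) i ^ 2 := by
      have h := apply_ofReal A.α A.β x (fun i => v.getD i 0) (fun _ => 0) i
      have h0 : apply A.α A.β x (fun _ => 0) i = 0 := by cases i <;> simp [apply, delay]
      simp only [h0, Complex.ofReal_zero, zero_mul, add_zero] at h
      rw [h, Complex.norm_real, Real.norm_eq_abs, sq_abs]
    refine A.J_matrix.exists_mem_spectrum (L := size n) hn.le
      (fun i => ((v.getD i 0 : ℝ) : ℂ)) (fun i hi => ?_) ?_ ?_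
    · have hl := (mem_vectors.1 hv).1
      simp [hl, hi]
    · simpa only [Complex.norm_real, Real.norm_eq_abs, sq_abs, normSq] using hpos
    · simpa only [hcast, Complex.norm_real, Real.norm_eq_abs, sq_abs, normSq, residual] using hres

/-- Completeness is what the threshold is for. The factor 4 comes from points with `|x| < 1 + 4 *
ε`, which are matched with their projection to [-1, 1]. -/
theorem exists_mem_approximation {size : ℕ → ℕ} {n : ℕ} (hsize : A.threshold n < size n) {z : ℂ}
    (hz : z ∈ _root_.spectrum ℂ A.J) :
    ∃ p ∈ A.approximation size n, ∃ y : ℝ, p.1 ≤ y ∧ y ≤ p.2 ∧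
      dist z y ≤ 4 * ((n : ℝ) + 1)⁻¹ := by
  have hn : 0 < ((n : ℝ) + 1)⁻¹ := by positivity
  obtain ⟨x, rfl⟩ := A.J_matrix.exists_ofReal_eq hz
  have hdist (y : ℝ) : dist (x : ℂ) y = |y - x| := by
    rw [dist_comm, dist_eq_norm, ← Complex.ofReal_sub, Complex.norm_real, Real.norm_eq_abs]
  simp only [hdist]
  by_cases hx : 1 + 4 * ((n : ℝ) + 1)⁻¹ ≤ |x|
  · have htail (k : ℕ) (hk : A.cut n ≤ k) := A.tail_lt hn hk
    have hn1 : (1 : ℝ) ≤ n + 1 := by linarith [n.cast_nonneg (α := ℝ)]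
    obtain ⟨R, hR⟩ : ∃ R : ℕ, (R : ℝ) = 1000 * ((n : ℝ) + 1) ^ 2 :=
      ⟨1000 * (n + 1) ^ 2, by push_cast; ring⟩
    rw [threshold] at hsize
    push_cast at hsize
    rw [← hR] at hsize
    have hRN : A.cut n + R ≤ size n := by
      have : ((A.cut n + R : ℕ) : ℝ) ≤ size n := by
        push_cast
        linarith [sq_nonneg ((6 * A.bound n + 2) * ((n : ℝ) + 1))]
      exact_mod_cast this
    have hCN : 100 * (6 * A.bound n + 2) ^ 2 ≤ ((n : ℝ) + 1)⁻¹ ^ 2 * size n := by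
      rw [inv_pow, inv_mul_eq_div, le_div_iff₀ (by positivity)]
      rw [mul_pow] at hsize
      linarith [(A.cut n).cast_nonneg (α := ℝ), R.cast_nonneg (α := ℝ)]
    obtain ⟨y, hy, hyx, v, hv0, hv, hpos, hres⟩ := A.J_matrix.exists_grid_eigenvector hn
      (inv_le_one_of_one_le₀ hn1) (by linarith [A.two_le_bound n]) hz
      (fun k => (A.abs_le_bound n k).1) (fun k => (A.abs_le_bound n k).2)
      (fun k hk => (htail k hk).1.le)
      (fun k hk => by
        have h1 := (htail k hk).2
        rw [abs_lt] at h1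
        rw [abs_of_pos (A.β_pos k)]
        linarith [h1.2]) hx (le_of_eq (by rw [hR]; field_simp)) hRN hCN
    have hget (i : ℕ) : ((List.range (size n)).map v).getD i 0 = v i := by
      by_cases hi : i < size n
      · simp [hi]
      · rw [List.getD_eq_default _ _ (by simpa using hi), hv0 i (by omega)]
    refine ⟨(y, y), A.mem_approximation.2 (Or.inr ⟨y, mem_tabulate.2 hy,
      (List.range (size n)).map v, mem_vectors.2 ⟨by simp, ?_⟩, ?_, ?_, rfl⟩), y, le_rfl, le_rfl,
      by linarith⟩
    · simp only [List.mem_map, List.mem_range]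
      rintro _ ⟨i, hi, rfl⟩
      exact mem_tabulate.2 (hv i hi)
    · simpa only [normSq, hget] using hpos
    · simpa only [normSq, residual, hget] using hres
  · push Not at hx
    refine ⟨(-1, 1), A.mem_approximation.2 (Or.inl rfl), max (-1) (min 1 x), le_max_left _ _,
      max_le (by norm_num) (min_le_left _ _), ?_⟩
    rw [abs_lt] at hx
    rw [abs_le]
    constructor <;> cases max_cases (-1) (min 1 x) <;> cases min_cases 1 x <;> linarith [hx.1, hx.2]

end Input

/-- The union of the intervals in a list. -/
def union (d : List (ℝ × ℝ)) : Set ℂ :=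
  {z : ℂ | ∃ p ∈ d, ∃ x : ℝ, p.1 ≤ x ∧ x ≤ p.2 ∧ z = (x : ℂ)}

theorem isCompact_union (d : List (ℝ × ℝ)) : IsCompact (union d) := by
  have h : union d = ⋃ p ∈ {p | p ∈ d}, Complex.ofReal '' Set.Icc p.1 p.2 := by
    ext z
    simp only [union, Set.mem_ofPred_eq, Set.mem_iUnion, Set.mem_image, Set.mem_Icc, exists_prop]
    refine exists_congr fun p => and_congr_right fun _ => exists_congr fun x => ?_
    rw [and_assoc, eq_comm]
  rw [h]
  exact d.finite_toSet.isCompact_biUnion fun p _ =>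
    isCompact_Icc.image Complex.continuous_ofReal

/-! ### The programs -/

section Programs

open Input

variable {a : Ty}

theorem computes_α {k : Input → a.Val → ℕ} (hk : Computes Input.datum a .nat k) :
    Computes Input.datum a .real (fun A x => A.α (k A x)) :=
  (Computes.query (S := signature) Query.diagonal : Computes Input.datum .nat .real
    (fun A i => A.α i)).comp hk

theorem computes_β {k : Input → a.Val → ℕ} (hk : Computes Input.datum a .nat k) :
    Computes Input.datum a .real (fun A x => A.β (k A x)) :=
  (Computes.query (S := signature) Query.offDiagonal : Computes Input.datum .nat .real
    (fun A i => A.β i)).comp hk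

theorem computes_M {ε : Input → a.Val → ℝ} (hε : Computes Input.datum a .real ε) :
    Computes Input.datum a .nat (fun A x => A.M (ε A x)) :=
  (Computes.query (S := signature) Query.modulus : Computes Input.datum .real .nat
    (fun A i => A.M i)).comp hε

variable {n : Input → a.Val → ℕ}

theorem computes_inv_succ (hn : Computes Input.datum a .nat n) :
    Computes Input.datum a .real (fun A x => ((n A x : ℝ) + 1)⁻¹) :=
  (hn.natCast.add .real_one).inv fun _ _ => by positivity

theorem computes_cut (hn : Computes Input.datum a .nat n) :
    Computes Input.datum a .nat (fun A x => A.cut (n A x)) :=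
  computes_M (computes_inv_succ hn)

theorem computes_bound (hn : Computes Input.datum a .nat n) :
    Computes Input.datum a .real (fun A x => A.bound (n A x)) :=
  (Computes.real_one.add .real_one).add
    (Computes.sum_range (f := fun A (x : a.Val × ℕ) => A.α x.2 ^ 2 + A.β x.2 ^ 2)
      ((computes_α .snd).sq.add (computes_β .snd).sq) (computes_cut hn))

theorem computes_threshold (hn : Computes Input.datum a .nat n) :
    Computes Input.datum a .real (fun A x => A.threshold (n A x)) :=
  have h := hn.natCast.add .real_one
  ((computes_cut hn).natCast.add ((Computes.nat_const 1000).natCast.mul h.sq)).add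
    ((Computes.nat_const 100).natCast.mul
      ((((Computes.nat_const 6).natCast.mul (computes_bound hn)).add
        (Computes.nat_const 2).natCast).mul h).sq)

open Classical in
-- Unbounded search replaces the missing rounding operation from reals to natural numbers.
theorem exists_computes_size : ∃ size : Input → ℕ → ℕ,
    Computes Input.datum .nat .nat size ∧ ∀ A n, A.threshold n < size A n := by
  have hk : Computes Input.datum (.prod .nat .nat) .nat (fun _ (x : ℕ × ℕ) => x.2) := .snd
  have ht : Computes Input.datum (.prod .nat .nat) .real
      (fun A (x : ℕ × ℕ) => A.threshold x.1) := computes_threshold .fst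
  have h : Computes Input.datum (.prod .nat .nat) .nat
      (fun A (x : ℕ × ℕ) => if A.threshold x.1 < x.2 then (0 : ℕ) else 1) :=
    Computes.ite_lt (b := .nat) ht hk.natCast (.nat_const 0) (.nat_const 1)
  obtain ⟨size, hsize, hs⟩ := h.exists_search fun A n => by
    obtain ⟨k, hk⟩ := exists_nat_gt (A.threshold n)
    exact ⟨k, if_pos hk⟩
  refine ⟨size, hsize, fun A n => ?_⟩
  by_contra hlt
  have := hs A n
  simp only [if_neg hlt] at this
  exact one_ne_zero this

theorem computes_grid (hn : Computes Input.datum a .nat n) :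
    Computes Input.datum a (.list .real) (fun A x => grid (n A x)) := by
  have h0 : Computes Input.datum (.prod a .nat) .nat (fun A (x : a.Val × ℕ) => n A x.1) :=
    hn.comp .fst
  have h1 : Computes Input.datum (.prod a .nat) .real
      (fun A (x : a.Val × ℕ) => (x.2 : ℝ) * (n A x.1 : ℝ)⁻¹) := by
    classical
    -- Inversion of 0 does not halt, whereas `0⁻¹ = 0` in `gridPoint`. The inner test keeps the
    -- denominator nonzero, since both branches must be total; the outer one restores the value 0.
    have h2 := Computes.ite_lt (b := .real) Computes.real_zero h0.natCast
      ((Computes.natCast (n := fun _ (x : a.Val × ℕ) => x.2) .snd).mul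
        (Computes.inv (f := fun A (x : a.Val × ℕ) => if (0 : ℝ) < (n A x.1 : ℝ) then
          (n A x.1 : ℝ) else 1)
        (Computes.ite_lt (b := .real) Computes.real_zero h0.natCast h0.natCast Computes.real_one)
        fun A x => by split_ifs with h <;> [exact h.ne'; exact one_ne_zero]))
      Computes.real_zero
    convert h2 using 3 with A x
    split_ifs with h
    · rfl
    · rw [le_antisymm (not_lt.1 h) (Nat.cast_nonneg _), inv_zero, mul_zero]
  exact Computes.tabulate (f := fun A (x : a.Val × ℕ) => gridPoint (n A x.1) x.2)
    (h1.sub h0.natCast) (((Computes.nat_const 2).nat_mul (hn.nat_mul hn)).nat_succ)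

theorem computes_normSq {v : Input → a.Val → List ℝ} (hn : Computes Input.datum a .nat n)
    (hv : Computes Input.datum a (.list .real) v) :
    Computes Input.datum a .real (fun A x => normSq (n A x) (v A x)) :=
  Computes.sum_range (f := fun A (x : a.Val × ℕ) => (v A x.1).getD x.2 0 ^ 2)
    (Computes.getD (l := fun A (x : a.Val × ℕ) => v A x.1) (hv.comp .fst) .snd).sq hn

theorem computes_residual {v : Input → a.Val → List ℝ} {y : Input → a.Val → ℝ}
    (hn : Computes Input.datum a .nat n) (hy : Computes Input.datum a .real y)
    (hv : Computes Input.datum a (.list .real) v) :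
    Computes Input.datum a .real (fun A x => A.residual (n A x) (y A x) (v A x)) := by
  have hy' : Computes Input.datum (.prod a .nat) .real (fun A (x : a.Val × ℕ) => y A x.1) :=
    hy.comp .fst
  have hv' : Computes Input.datum (.prod a .nat) (.list .real)
      (fun A (x : a.Val × ℕ) => v A x.1) := hv.comp .fst
  have hi : Computes Input.datum (.prod a .nat) .nat (fun _ (x : a.Val × ℕ) => x.2) := .snd
  have h1 : Computes Input.datum (.prod a .nat) .real (fun A (x : a.Val × ℕ) =>
      (apply A.α A.β (y A x.1) (fun i => (v A x.1).getD i 0) x.2) ^ 2) := by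
    have h2 := (((((computes_α hi).sub hy').mul (hv'.getD hi)).add
      ((computes_β hi).mul (hv'.getD hi.nat_succ))).add ((computes_β hi.nat_pred).mul
        -- Prefixing 0 to the list of entries realises `delay`.
        (Computes.getD (Computes.cons (b := .real) Computes.real_zero hv') hi))).sq
    convert h2 using 3 with A x
    obtain ⟨x, i⟩ := x
    cases i <;> rfl
  exact Computes.sum_range h1 hn.nat_succ

theorem computes_approximation {size : Input → ℕ → ℕ}
    (hsize : Computes Input.datum .nat .nat size) :
    Computes Input.datum .nat intervals (fun A n => A.approximation (size A) n) := by
  classical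
  let Γ : Ty := .prod (.prod .nat .real) (.list .real)
  have hn : Computes Input.datum Γ .nat (fun _ (x : (ℕ × ℝ) × List ℝ) => x.1.1) :=
    Computes.comp .fst .fst
  have hy : Computes Input.datum Γ .real (fun _ (x : (ℕ × ℝ) × List ℝ) => x.1.2) :=
    Computes.comp .snd .fst
  have hv : Computes Input.datum Γ (.list .real) (fun _ (x : (ℕ × ℝ) × List ℝ) => x.2) := .snd
  have hs : Computes Input.datum Γ .nat (fun A (x : (ℕ × ℝ) × List ℝ) => size A x.1.1) :=
    hsize.comp hn
  have hV := computes_normSq hs hv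
  have htest : Computes Input.datum Γ intervals (fun A (x : (ℕ × ℝ) × List ℝ) =>
      if 0 < normSq (size A x.1.1) x.2 then
        if ((x.1.1 : ℝ) + 1)⁻¹ ^ 2 * normSq (size A x.1.1) x.2 <
          A.residual (size A x.1.1) x.1.2 x.2 then [] else [(x.1.2, x.1.2)]
      else []) :=
    Computes.ite_lt (b := intervals) Computes.real_zero hV
      (Computes.ite_lt (b := intervals) ((computes_inv_succ hn).sq.mul hV)
        (computes_residual hs hy hv) Computes.nil
        (Computes.cons (b := .prod .real .real) (hy.pair hy) Computes.nil)) Computes.nil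
  have hg := computes_grid hsize
  have hvec := hg.vectors hsize
  have h1 : Computes Input.datum (.prod .nat .real) intervals (fun A (x : ℕ × ℝ) =>
      (vectors (grid (size A x.1)) (size A x.1)).flatMap fun v =>
        if 0 < normSq (size A x.1) v then
          if ((x.1 : ℝ) + 1)⁻¹ ^ 2 * normSq (size A x.1) v < A.residual (size A x.1) x.2 v then []
            else [(x.2, x.2)]
        else []) :=
    Computes.flatMap (a := .prod .nat .real) (b := .prod .real .real) (c := .list .real)
      (l := fun A (x : ℕ × ℝ) => vectors (grid (size A x.1)) (size A x.1)) htest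
      (hvec.comp .fst)
  have h2 := Computes.flatMap (a := .nat) (b := .prod .real .real) (c := .real)
    (l := fun A (x : ℕ) => grid (size A x)) h1 hg
  exact Computes.cons (b := .prod .real .real)
    (f := fun _ _ => ((-1 : ℝ), (1 : ℝ))) (Computes.real_one.neg.pair .real_one) h2

open Classical in
theorem exists_computes_index : ∃ index : Input → ℝ → ℕ,
    Computes Input.datum .real .nat index ∧
      ∀ A ε, 0 < ε → 4 < ε * ((index A ε : ℝ) + 1) := by
  have hk : Computes Input.datum (.prod .real .nat) .nat (fun _ (x : ℝ × ℕ) => x.2) := .snd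
  have hε : Computes Input.datum (.prod .real .nat) .real (fun _ (x : ℝ × ℕ) => x.1) := .fst
  -- The value 0 for nonpositive `ε` lets the search halt there too, as totality requires.
  have h : Computes Input.datum (.prod .real .nat) .nat (fun _ (x : ℝ × ℕ) =>
      if 0 < x.1 then if ((4 : ℕ) : ℝ) < x.1 * ((x.2 : ℝ) + 1) then (0 : ℕ) else 1 else 0) :=
    Computes.ite_lt (b := .nat) Computes.real_zero hε
      (Computes.ite_lt (b := .nat) (Computes.nat_const 4).natCast
        (hε.mul (hk.natCast.add .real_one)) (.nat_const 0) (.nat_const 1)) (.nat_const 0)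
  obtain ⟨index, hindex, hi⟩ := h.exists_search fun A (ε : ℝ) => by
    by_cases hε : 0 < ε
    · obtain ⟨k, hk⟩ := exists_nat_gt (4 / ε)
      rw [div_lt_iff₀ hε] at hk
      refine ⟨k, ?_⟩
      simp only [if_pos hε]
      rw [if_pos]
      push_cast
      nlinarith
    · exact ⟨0, if_neg hε⟩
  refine ⟨index, hindex, fun A ε hε => ?_⟩
  by_contra hlt
  have := hi A ε
  simp only [if_pos hε] at this
  rw [if_neg (by push_cast; exact hlt)] at this
  exact one_ne_zero this

end Programs

end Jacobi

/-! ### Assembly of the two programs. -/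

theorem theorem6p7 :
    RealRAM.ComputableWithErrorControl (S := Jacobi.signature) (Ω := Jacobi.Input)
      Jacobi.Input.datum (𝓜 := TopologicalSpace.NonemptyCompacts ℂ) (out := Jacobi.intervals)
      Jacobi.DescribesUnion Jacobi.Input.spectrum := by
  obtain ⟨size, hsize, hthreshold⟩ := Jacobi.exists_computes_size
  obtain ⟨approx, happrox⟩ := Jacobi.computes_approximation hsize
  obtain ⟨index, ⟨indexProg, hindexProg⟩, hindex⟩ := Jacobi.exists_computes_index
  refine ⟨approx, indexProg, fun A => ?_⟩
  let G (n : ℕ) : TopologicalSpace.NonemptyCompacts ℂ :=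
    ⟨⟨Jacobi.union (A.approximation (size A) n), Jacobi.isCompact_union _⟩,
      ⟨((1 : ℝ) : ℂ), (-1, 1), A.mem_approximation.2 (Or.inl rfl), 1, by norm_num, le_rfl, rfl⟩⟩
  -- Soundness and completeness bound the two one-sided distances.
  have hdist (n : ℕ) : dist (G n) A.spectrum ≤ 4 * ((n : ℝ) + 1)⁻¹ := by
    rw [Metric.NonemptyCompacts.dist_eq]
    refine Metric.hausdorffDist_le_of_mem_dist (by positivity) ?_ ?_
    · rintro _ ⟨p, hp, x, h1, h2, rfl⟩
      obtain ⟨z, hz, hd⟩ := A.exists_mem_spectrum_of_mem_approximation hp h1 h2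
      exact ⟨z, hz, hd.trans (by linarith [show 0 < ((n : ℝ) + 1)⁻¹ by positivity])⟩
    · intro z hz
      obtain ⟨p, hp, y, h1, h2, hd⟩ := A.exists_mem_approximation (hthreshold A n) hz
      exact ⟨y, ⟨p, hp, y, h1, h2, rfl⟩, hd⟩
  refine ⟨G, fun n => ⟨_, ?_, rfl⟩, ?_, fun ε hε => ⟨index A ε, ?_, ?_⟩⟩
  · rw [happrox A n]
    exact Part.mem_some _
  · rw [tendsto_iff_dist_tendsto_zero]
    refine squeeze_zero (fun _ => dist_nonneg) hdist ?_
    simpa [one_div] using (tendsto_one_div_add_atTop_nhds_zero_nat (𝕜 := ℝ)).const_mul 4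
  · rw [hindexProg A ε]
    exact Part.mem_some _
  · refine (hdist _).trans_lt ?_
    rw [← div_eq_mul_inv, div_lt_iff₀ (by positivity)]
    exact hindex A ε hε
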